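/- **Setting.** Let $n\ge 1$, $\boldsymbol\mu\in\mathbb R^n$, $\boldsymbol\alpha\in\mathbb R^n$, let $\boldsymbol\Omega$ be a positive definite $n\times n$ matrix and $\boldsymbol\omega=\mathrm{diag}(\boldsymbol\Omega)^{1/2}$. Let $g=g^{(n+1)}$ be a Borel function, non-negative on $[0,\infty)$, with $0<\int_0^\infty u^{\frac{n+1}{2}-1}g(u)\,du<\infty$. For a generator $h$ put $c_k(h)=\big(\int_{\mathbb R^k}h(x'x)\,dx\big)^{-1}$; the elliptical law $EC_k(m,\Sigma,h)$ has density $c_k(h)|\Sigma|^{-1/2}h\big((x-m)'\Sigma^{-1}(x-m)\big)$. Put $q(x)=(x-\boldsymbol\mu)'\boldsymbol\Omega^{-1}(x-\boldsymbol\mu)$, $g^{(n)}(u)=\int_0^\infty r^{-1/2}g^{(n+1)}(r+u)\,dr$, $g_q(u)=g^{(n+1)}(u+q)/g^{(n)}(q)$. The law $SE_n(\boldsymbol\mu,\boldsymbol\Omega,\boldsymbol\alpha,g^{(n+1)})$ is the one with density $$2\,f_{g^{(n)}}(x;\boldsymbol\mu,\boldsymbol\Omega)\,F_{g_{q(x)}}\big(\boldsymbol\alpha'\boldsymbol\omega^{-1}(x-\boldsymbol\mu)\big),\qquad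 x\in\mathbb R^n,$$ where $f_{g^{(n)}}$ is the density of $EC_n(\boldsymbol\mu,\boldsymbol\Omega,g^{(n)})$ and $F_{g_q}$ the distribution function of $EC_1(0,1,g_q)$. **Theorem 3.1.** Let $\mathbf X\sim SE_n(\boldsymbol\mu,\boldsymbol\Omega,\boldsymbol\alpha,g^{(n+1)})$. There is exactly one pair $(\boldsymbol\delta,\boldsymbol\Psi)$ with $\boldsymbol\delta\in(-1,1)^n$ and $\boldsymbol\Psi$ a full rank correlation matrix such that, with $\boldsymbol\Delta=\mathrm{diag}\big((1-\delta_i^2)^{1/2}\big)$ and $\boldsymbol\lambda=\boldsymbol\Delta^{-1}\boldsymbol\delta$, $$\boldsymbol\omega^{-1}\boldsymbol\Omega\boldsymbol\omega^{-1}=\boldsymbol\Delta(\boldsymbol\Psi+\boldsymbol\lambda\boldsymbol\lambda')\boldsymbol\Delta,\qquad \boldsymbol\alpha=(1+\boldsymbol\lambda'\boldsymbol\Psi^{-1}\boldsymbol\lambda)^{-1/2}\boldsymbol\Delta^{-1}\boldsymbol\Psi^{-1}\boldsymbol\lambda .$$ Let $\boldsymbol\Psi^{1/2}$ be the positive definite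 square root of $\boldsymbol\Psi$, and write $U^{(k)}$ for a uniform vector on the unit sphere of $\mathbb R^k$ (so $U^{(1)}=\pm1$). Then $\mathbf X$ has the following stochastic representations. (a) $\mathbf X\overset d= R_0\big(\boldsymbol{\omega\delta}|U_1|+\boldsymbol{\omega\Delta\Psi}^{1/2}\mathbf U_2\big)+\boldsymbol\mu$, where $R_0$ has density $h(r)=c_{n+1}(g)\frac{2\pi^{(n+1)/2}}{\Gamma((n+1)/2)}r^ng(r^2)$, $r>0$, and $(U_1,\mathbf U_2')'$, with $U_1$ real and $\mathbf U_2\in\mathbb R^n$, is uniform on the unit sphere of $\mathbb R^{n+1}$ and independent of $R_0$. (b) $\mathbf X\overset d= R_0\big(d_1\boldsymbol{\omega\delta}|U^{(1)}|+d_2\boldsymbol{\omega\Delta\Psi}^{1/2}\mathbf U^{(n)}\big)+\boldsymbol\mu$, where $R_0$ is distributed as in (a), $d_1,d_2\ge0$, $d_1^2\sim\mathrm{Beta}(\frac12,\frac n2)$, $d_2^2=1-d_1^2$, and $R_0,(d_1,d_2),U^{(1)},\mathbf U^{(n)}$ are mutually independent. Moreover $(U_1,\mathbf U_2)\overset d=(d_1U^{(1)},d_2\mathbf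 U^{(n)})$. (c) $\mathbf X\overset d= R_1\boldsymbol{\omega\delta}|U^{(1)}|+R_n\boldsymbol{\omega\Delta\Psi}^{1/2}\mathbf U^{(n)}+\boldsymbol\mu$, where $(R_1,R_n)\overset d=(d_1R_0,\sqrt{1-d_1^2}\,R_0)$ with $R_0,d_1$ as in (b), and $(R_1,R_n),U^{(1)},\mathbf U^{(n)}$ are mutually independent. With $R_0,d_1,U^{(1)},\mathbf U^{(n)}$ as in (b), one may take $R_1=d_1R_0$, $R_n=\sqrt{1-d_1^2}\,R_0$. Random variables as described exist, and each representation holds for every choice of them, on any probability space. -/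

import Mathlib

open MeasureTheory ProbabilityTheory Set Matrix
open scoped MatrixOrder

/- Vectors of `ℝⁿ` are functions `Fin n → ℝ` (with Lebesgue measure `volume`); the Euclidean
norm enters only through the unit sphere, which lives in `EuclideanSpace ℝ (Fin k)`. -/

noncomputable section

namespace SkewElliptical

/-- `g` is a density generator in dimension `k`: a (Borel) function, non-negative on `[0, ∞)`,
with `0 < ∫₀^∞ u^{k/2 - 1} g(u) du < ∞`. -/
structure IsDensityGenerator (k : ℕ) (g : ℝ → ℝ) : Prop where
  measurable : Measurable g
  nonneg : ∀ u, 0 ≤ u → 0 ≤ g u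
  integrable : IntegrableOn (fun u : ℝ => u ^ ((k : ℝ) / 2 - 1) * g u) (Ioi 0)
  pos : 0 < ∫ u in Ioi (0 : ℝ), u ^ ((k : ℝ) / 2 - 1) * g u

/-- The normalizing constant `c_k` of the generator `g` in dimension `k`: the reciprocal of the
integral of `x ↦ g(x'x)` over `ℝᵏ`. -/
def normConst (k : ℕ) (g : ℝ → ℝ) : ℝ :=
  (∫ x : Fin k → ℝ, g (x ⬝ᵥ x))⁻¹

/-- The quadratic form `q(x) = (x - m)' S⁻¹ (x - m)`. -/
def quadForm {k : ℕ} (m : Fin k → ℝ) (S : Matrix (Fin k) (Fin k) ℝ) (x : Fin k → ℝ) : ℝ :=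
  (x - m) ⬝ᵥ (S⁻¹ *ᵥ (x - m))

/-- The density of the elliptical law `EC_k(m, S, g)`. -/
def ecDensity {k : ℕ} (m : Fin k → ℝ) (S : Matrix (Fin k) (Fin k) ℝ) (g : ℝ → ℝ)
    (x : Fin k → ℝ) : ℝ :=
  normConst k g * S.det ^ (-(1 / 2) : ℝ) * g (quadForm m S x)

/-- The cumulative distribution function of `EC_1(0, 1, g)`. -/
def ecCdf (g : ℝ → ℝ) (t : ℝ) : ℝ :=
  ∫ s in Iic t, ecDensity (0 : Fin 1 → ℝ) (1 : Matrix (Fin 1) (Fin 1) ℝ) g ![s]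

/-- The marginal generator: `g^{(n)}(u) = ∫₀^∞ r^{-1/2} g^{(n+1)}(r + u) dr`. -/
def marginalGen (g : ℝ → ℝ) (u : ℝ) : ℝ :=
  ∫ r in Ioi (0 : ℝ), r ^ (-(1 / 2) : ℝ) * g (r + u)

/-- The conditional generator: `g_q(u) = g^{(n+1)}(u + q) / g^{(n)}(q)`. -/
def conditionalGen (g : ℝ → ℝ) (q u : ℝ) : ℝ :=
  g (u + q) / marginalGen g q

/-- The scale matrix `ω = diag(Ω)^{1/2}`. -/
def scaleMatrix {n : ℕ} (Om : Matrix (Fin n) (Fin n) ℝ) : Matrix (Fin n) (Fin n) ℝ :=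
  diagonal fun i => √(Om i i)

/-- The correlation matrix `ω⁻¹ Ω ω⁻¹`. -/
def corrMatrix {n : ℕ} (Om : Matrix (Fin n) (Fin n) ℝ) : Matrix (Fin n) (Fin n) ℝ :=
  (scaleMatrix Om)⁻¹ * Om * (scaleMatrix Om)⁻¹

/-- The density of the skew-elliptical law `SE_n(m, Ω, α, g)`, with `g = g^{(n+1)}`:
`2 f_{g^{(n)}}(x; m, Ω) F_{g_{q(x)}}(α' ω⁻¹ (x - m))`. -/
def skewDensity {n : ℕ} (m : Fin n → ℝ) (Om : Matrix (Fin n) (Fin n) ℝ) (α : Fin n → ℝ)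
    (g : ℝ → ℝ) (x : Fin n → ℝ) : ℝ :=
  2 * ecDensity m Om (marginalGen g) x *
    ecCdf (conditionalGen g (quadForm m Om x)) (α ⬝ᵥ ((scaleMatrix Om)⁻¹ *ᵥ (x - m)))

/-- The skew-elliptical law `SE_n(m, Ω, α, g)`. -/
def skewLaw {n : ℕ} (m : Fin n → ℝ) (Om : Matrix (Fin n) (Fin n) ℝ) (α : Fin n → ℝ)
    (g : ℝ → ℝ) : Measure (Fin n → ℝ) :=
  volume.withDensity fun x => ENNReal.ofReal (skewDensity m Om α g x)

/-- The matrix `Δ = diag((1 - δ₁²)^{1/2}, …, (1 - δₙ²)^{1/2})`. -/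
def deltaMatrix {n : ℕ} (δ : Fin n → ℝ) : Matrix (Fin n) (Fin n) ℝ :=
  diagonal fun i => √(1 - δ i ^ 2)

/-- The vector `λ = Δ⁻¹ δ`. -/
def lam {n : ℕ} (δ : Fin n → ℝ) : Fin n → ℝ :=
  (deltaMatrix δ)⁻¹ *ᵥ δ

/-- The pair `(δ, Ψ)` parametrizes `(Ω, α)`: the entries of `δ` lie in `(-1, 1)`, `Ψ` is a full
rank correlation matrix, `ω⁻¹Ωω⁻¹ = Δ(Ψ + λλ')Δ` and
`α = (1 + λ'Ψ⁻¹λ)^{-1/2} Δ⁻¹Ψ⁻¹λ`. -/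
structure IsSkewParam {n : ℕ} (Om : Matrix (Fin n) (Fin n) ℝ) (α δ : Fin n → ℝ)
    (Psi : Matrix (Fin n) (Fin n) ℝ) : Prop where
  delta_mem : ∀ i, δ i ∈ Ioo (-1 : ℝ) 1
  posDef : Psi.PosDef
  diag_one : ∀ i, Psi i i = 1
  corr_eq : corrMatrix Om =
    deltaMatrix δ * (Psi + vecMulVec (lam δ) (lam δ)) * deltaMatrix δ
  alpha_eq : α = ((1 + lam δ ⬝ᵥ (Psi⁻¹ *ᵥ lam δ)) ^ (-(1 / 2) : ℝ)) •
    ((deltaMatrix δ)⁻¹ *ᵥ (Psi⁻¹ *ᵥ lam δ))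

/-- The uniform law on the unit sphere of `ℝᵏ`: normalized surface measure. -/
def uniformSphere (k : ℕ) : Measure (EuclideanSpace ℝ (Fin k)) :=
  ((volume : Measure (EuclideanSpace ℝ (Fin k))).toSphere univ)⁻¹ •
    (volume : Measure (EuclideanSpace ℝ (Fin k))).toSphere.map Subtype.val

/-- The law on `(0, ∞)` with density
`h(r) = c_{n+1} (2 π^{(n+1)/2} / Γ((n+1)/2)) rⁿ g(r²)`. -/
def radialLaw (n : ℕ) (g : ℝ → ℝ) : Measure ℝ :=
  (volume.restrict (Ioi 0)).withDensity fun r => ENNReal.ofReal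
    (normConst (n + 1) g *
      (2 * Real.pi ^ (((n : ℝ) + 1) / 2) / Real.Gamma (((n : ℝ) + 1) / 2)) * r ^ n * g (r ^ 2))

/-- Mutual independence of three random variables. -/
def MutIndep₃ {Ω A B C : Type*} [MeasurableSpace Ω] [MeasurableSpace A] [MeasurableSpace B]
    [MeasurableSpace C] (X : Ω → A) (Y : Ω → B) (Z : Ω → C) (P : Measure Ω) : Prop :=
  IndepFun X (fun w => (Y w, Z w)) P ∧ IndepFun Y Z P

/-- Mutual independence of four random variables. -/
def MutIndep₄ {Ω A B C D : Type*} [MeasurableSpace Ω] [MeasurableSpace A] [MeasurableSpace B]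
    [MeasurableSpace C] [MeasurableSpace D] (X : Ω → A) (Y : Ω → B) (Z : Ω → C) (T : Ω → D)
    (P : Measure Ω) : Prop :=
  IndepFun X (fun w => (Y w, Z w, T w)) P ∧ MutIndep₃ Y Z T P

/-- The last `n` coordinates of a vector of `ℝⁿ⁺¹`. -/
def tailVec {n : ℕ} (u : EuclideanSpace ℝ (Fin (n + 1))) : Fin n → ℝ :=
  fun i => u i.succ

/-- The ingredients of the first representation: `R₀` has the radial law, `U = (U₁, U₂)` is
uniform on the unit sphere of `ℝⁿ⁺¹`, and they are independent. -/
structure IsDataA {n : ℕ} {Ω : Type*} [MeasurableSpace Ω] (g : ℝ → ℝ) (P : Measure Ω)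
    (R₀ : Ω → ℝ) (U : Ω → EuclideanSpace ℝ (Fin (n + 1))) : Prop where
  law_R₀ : HasLaw R₀ (radialLaw n g) P
  law_U : HasLaw U (uniformSphere (n + 1)) P
  indep : IndepFun R₀ U P

/-- The ingredients of the second representation: `R₀` has the radial law, `d₁, d₂ ≥ 0`,
`d₁² ~ Beta(1/2, n/2)`, `d₂² = 1 - d₁²`, `V` and `W` are uniform on the unit spheres of `ℝ¹` and
`ℝⁿ`, and `R₀, (d₁, d₂), V, W` are independent. -/
structure IsDataB {n : ℕ} {Ω : Type*} [MeasurableSpace Ω] (g : ℝ → ℝ) (P : Measure Ω)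
    (R₀ d₁ d₂ : Ω → ℝ) (V : Ω → EuclideanSpace ℝ (Fin 1)) (W : Ω → EuclideanSpace ℝ (Fin n)) :
    Prop where
  law_R₀ : HasLaw R₀ (radialLaw n g) P
  nonneg_d₁ : ∀ᵐ w ∂P, 0 ≤ d₁ w
  nonneg_d₂ : ∀ᵐ w ∂P, 0 ≤ d₂ w
  law_d₁ : HasLaw (fun w => d₁ w ^ 2) (betaMeasure (1 / 2) ((n : ℝ) / 2)) P
  sq_d₂ : ∀ᵐ w ∂P, d₂ w ^ 2 = 1 - d₁ w ^ 2
  law_V : HasLaw V (uniformSphere 1) P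
  law_W : HasLaw W (uniformSphere n) P
  indep : MutIndep₄ R₀ (fun w => (d₁ w, d₂ w)) V W P

/-- The ingredients of the third representation: `(R₁, Rₙ)` has the law of
`(d₁ R₀, (1 - d₁²)^{1/2} R₀)`, `V` and `W` are uniform on the unit spheres of `ℝ¹` and `ℝⁿ`, and
`(R₁, Rₙ), V, W` are independent. -/
structure IsDataC {n : ℕ} {Ω Ω' : Type*} [MeasurableSpace Ω] [MeasurableSpace Ω']
    (P' : Measure Ω') (R₀ d₁ : Ω' → ℝ) (P : Measure Ω) (R₁ Rₙ : Ω → ℝ)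
    (V : Ω → EuclideanSpace ℝ (Fin 1)) (W : Ω → EuclideanSpace ℝ (Fin n)) : Prop where
  law_R : IdentDistrib (fun w => (R₁ w, Rₙ w))
    (fun w => (d₁ w * R₀ w, √(1 - d₁ w ^ 2) * R₀ w)) P P'
  law_V : HasLaw V (uniformSphere 1) P
  law_W : HasLaw W (uniformSphere n) P
  indep : MutIndep₃ (fun w => (R₁ w, Rₙ w)) V W P

end SkewElliptical

end

/-! Put `A = ωΔΨ^{1/2}` and `b = Ψ^{-1/2}λ`. Then `ωδ = A b` and `Ω = A (1 + bb') A'`. Let `(Z₁,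
Z₂)` be spherical in `ℝⁿ⁺¹` with generator `g` and constant `c = c_{n+1}(g)`. The vector `|Z₁| A b +
A Z₂ + μ` has at `x` the density `2c |det A|⁻¹ ∫₀^∞ g(t² + |v - t b|²) dt`, where `v = A⁻¹(x - μ)`.
Completing the square in `t`, with `k² = 1 + b'b`, turns this into `2c |Ω|^{-1/2} ∫ g(s² + q(x)) ds`
over `s < b'v/k`. Here Sherman–Morrison gives `q(x) = v'v - (b'v)²/k²`, the determinant lemma gives
`√det Ω = |det A| k`, and `b'v/k = α'ω⁻¹(x - μ)`.

The skew-elliptical density is the same integral: `g^{(n)}(q)` is the integral of `g(s² + q)` over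
the whole line, so it cancels the denominator of `g_q`, and `c_n(g^{(n)}) = c` by Fubini. Hence
`IsSkewParam.map_sphericalLaw`.

Polar coordinates `Z = R₀U` (`IsDensityGenerator.map_smul_radialLaw_prod`) give (a). Splitting `U`
into a beta mixture of uniform vectors in `ℝ` and `ℝⁿ` (`map_uniformSphere_succ`) gives (b).
Representation (c) regroups (b), since only the joint law of `(R₁, Rₙ), V, W` matters.

The parameters are determined because the correlation matrix sends `α` to a positive multiple of
`δ`, the factor being computable from `α`. The resulting formulas define a valid pair by
Cauchy–Schwarz. -/

/-! ### Polar coordinates and the radial decomposition of spherical laws. -/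

open scoped ENNReal in
/-- Polar coordinates: Lebesgue integral of a function on a finite dimensional normed space. -/
theorem lintegral_eq_lintegral_toSphere {E : Type*} [NormedAddCommGroup E] [NormedSpace ℝ E]
    [MeasurableSpace E] [BorelSpace E] [FiniteDimensional ℝ E] [Nontrivial E] (μ : Measure E)
    [μ.IsAddHaarMeasure] {f : E → ℝ≥0∞} (hf : Measurable f) :
    ∫⁻ x, f x ∂μ = ∫⁻ u : Metric.sphere (0 : E) 1, (∫⁻ r in Ioi (0 : ℝ),
      ENNReal.ofReal (r ^ (Module.finrank ℝ E - 1)) * f (r • (u : E))) ∂μ.toSphere := by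
  have hm : Measurable fun p : Metric.sphere (0 : E) 1 × Ioi (0 : ℝ) =>
      f ((p.2 : ℝ) • (p.1 : E)) := by fun_prop
  calc ∫⁻ x, f x ∂μ = ∫⁻ x : ({(0)}ᶜ : Set E), f x ∂(μ.comap (↑)) := by
        rw [lintegral_subtype_comap (measurableSet_singleton _).compl, restrict_compl_singleton]
    _ = ∫⁻ p, f ((p.2 : ℝ) • (p.1 : E))
          ∂μ.toSphere.prod (.volumeIoiPow (Module.finrank ℝ E - 1)) := by
        rw [← μ.measurePreserving_homeomorphUnitSphereProd.lintegral_comp hm]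
        refine lintegral_congr fun x => ?_
        have hx : ‖(x : E)‖ ≠ 0 := norm_ne_zero_iff.2 x.2
        simp [smul_smul, mul_inv_cancel₀ hx]
    _ = ∫⁻ u : Metric.sphere (0 : E) 1, ∫⁻ r : Ioi (0 : ℝ), f ((r : ℝ) • (u : E))
          ∂(.volumeIoiPow (Module.finrank ℝ E - 1)) ∂μ.toSphere :=
        lintegral_prod _ hm.aemeasurable
    _ = _ := by
        refine lintegral_congr fun u => ?_
        rw [Measure.volumeIoiPow, lintegral_withDensity_eq_lintegral_mul _ (by fun_prop)
          (by fun_prop)]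
        exact lintegral_subtype_comap measurableSet_Ioi
          (fun r : ℝ => ENNReal.ofReal (r ^ (Module.finrank ℝ E - 1)) * f (r • (u : E)))

noncomputable section

namespace SkewElliptical

open scoped ENNReal

/-- The surface area of the unit sphere of `ℝᵏ`. -/
def sphereArea (k : ℕ) : ℝ≥0∞ := (volume : Measure (EuclideanSpace ℝ (Fin k))).toSphere univ

theorem sphereArea_eq {k : ℕ} (hk : 1 ≤ k) : sphereArea k =
    ENNReal.ofReal (2 * Real.pi ^ ((k : ℝ) / 2) / Real.Gamma ((k : ℝ) / 2)) := by
  have : Nonempty (Fin k) := ⟨⟨0, hk⟩⟩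
  have hk' : (0 : ℝ) < k := by exact_mod_cast hk
  have hG : 0 < Real.Gamma ((k : ℝ) / 2) := Real.Gamma_pos_of_pos (by positivity)
  rw [sphereArea, Measure.toSphere_apply_univ, EuclideanSpace.volume_ball,
    finrank_euclideanSpace, Fintype.card_fin, ENNReal.ofReal_one, one_pow, one_mul,
    ← ENNReal.ofReal_natCast, ← ENNReal.ofReal_mul hk'.le, Real.Gamma_add_one (by positivity)]
  congr 1
  have : √Real.pi ^ k = Real.pi ^ ((k : ℝ) / 2) := by
    rw [Real.sqrt_eq_rpow, ← Real.rpow_natCast, ← Real.rpow_mul Real.pi_pos.le]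
    ring_nf
  rw [this]
  field_simp

theorem sphereArea_ne_zero {k : ℕ} (hk : 1 ≤ k) : sphereArea k ≠ 0 := by
  have hk' : (0 : ℝ) < k := by exact_mod_cast hk
  have hG : 0 < Real.Gamma ((k : ℝ) / 2) := Real.Gamma_pos_of_pos (by positivity)
  have := Real.pi_pos
  rw [sphereArea_eq hk, Ne, ENNReal.ofReal_eq_zero, not_le]
  positivity

theorem sphereArea_ne_top (k : ℕ) : sphereArea k ≠ ∞ := measure_ne_top _ _

theorem isProbabilityMeasure_uniformSphere {k : ℕ} (hk : 1 ≤ k) :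
    IsProbabilityMeasure (uniformSphere k) := by
  constructor
  rw [uniformSphere, Measure.smul_apply, Measure.map_apply (by fun_prop) .univ, preimage_univ]
  exact ENNReal.inv_mul_cancel (sphereArea_ne_zero hk) (sphereArea_ne_top k)

theorem lintegral_uniformSphere (k : ℕ) {f : EuclideanSpace ℝ (Fin k) → ℝ≥0∞}
    (hf : Measurable f) : ∫⁻ u, f u ∂uniformSphere k = (sphereArea k)⁻¹ *
      ∫⁻ u : Metric.sphere (0 : EuclideanSpace ℝ (Fin k)) 1, f u ∂volume.toSphere := by
  rw [uniformSphere, lintegral_smul_measure, lintegral_map hf (by fun_prop), smul_eq_mul,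
    sphereArea]

theorem norm_eq_one_ae_uniformSphere (k : ℕ) : ∀ᵐ u ∂uniformSphere k, ‖u‖ = 1 := by
  refine Measure.ae_smul_measure ?_ _
  rw [ae_map_iff (by fun_prop) (measurableSet_eq_fun (by fun_prop) (by fun_prop))]
  exact .of_forall fun u => by simp

/-- Polar coordinates in `ℝᵏ`, in terms of the uniform law on the sphere. -/
theorem lintegral_eq_uniformSphere {k : ℕ} (hk : 1 ≤ k) {f : EuclideanSpace ℝ (Fin k) → ℝ≥0∞}
    (hf : Measurable f) : ∫⁻ x, f x = sphereArea k * ∫⁻ u, (∫⁻ r in Ioi (0 : ℝ),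
      ENNReal.ofReal (r ^ (k - 1)) * f (r • u)) ∂uniformSphere k := by
  have : Nonempty (Fin k) := ⟨⟨0, hk⟩⟩
  rw [lintegral_uniformSphere, ← mul_assoc, ENNReal.mul_inv_cancel (sphereArea_ne_zero hk)
    (sphereArea_ne_top k), one_mul, lintegral_eq_lintegral_toSphere _ hf, finrank_euclideanSpace,
    Fintype.card_fin]
  exact Measurable.lintegral_prod_right' (f := fun p : EuclideanSpace ℝ (Fin k) × ℝ =>
    ENNReal.ofReal (p.2 ^ (k - 1)) * f (p.2 • p.1)) (by fun_prop)

theorem lintegral_ofLp {k : ℕ} (f : (Fin k → ℝ) → ℝ≥0∞) :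
    ∫⁻ z : EuclideanSpace ℝ (Fin k), f z.ofLp = ∫⁻ x, f x :=
  (EuclideanSpace.volume_preserving_symm_measurableEquiv_toLp (Fin k)).lintegral_comp_emb
    (MeasurableEquiv.measurableEmbedding _) f

theorem dotProduct_self_ofLp {k : ℕ} (z : EuclideanSpace ℝ (Fin k)) :
    z.ofLp ⬝ᵥ z.ofLp = ‖z‖ ^ 2 := by
  rw [EuclideanSpace.real_norm_sq_eq]
  simp [dotProduct, sq]

/-- The substitution `u = y²` turns `u^{k/2-1} g(u) du` into `2 y^{k-1} g(y²) dy`, the radial part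
of the integral over `ℝᵏ`. -/
theorem IsDensityGenerator.integrable_norm {k : ℕ} {g : ℝ → ℝ} (hk : 1 ≤ k)
    (hg : IsDensityGenerator k g) :
    Integrable (fun z : EuclideanSpace ℝ (Fin k) => g (‖z‖ ^ 2)) ∧
      0 < ∫ z : EuclideanSpace ℝ (Fin k), g (‖z‖ ^ 2) := by
  have : Nonempty (Fin k) := ⟨⟨0, hk⟩⟩
  have hk' : (0 : ℝ) < k := by exact_mod_cast hk
  have key : ∀ y ∈ Ioi (0 : ℝ), (y ^ ((2 : ℝ) - 1)) • ((y ^ (2 : ℝ)) ^ ((k : ℝ) / 2 - 1) *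
      g (y ^ (2 : ℝ))) = y ^ (k - 1) • g (y ^ 2) := by
    intro y hy
    have hy' : (0 : ℝ) < y := hy
    rw [← Real.rpow_mul hy'.le, smul_eq_mul, smul_eq_mul, ← mul_assoc, ← Real.rpow_add hy',
      Real.rpow_two, ← Real.rpow_natCast y (k - 1), Nat.cast_sub hk]
    congr 2
    push_cast
    ring
  constructor
  · rw [integrable_fun_norm_addHaar volume (f := fun y => g (y ^ 2)), finrank_euclideanSpace,
      Fintype.card_fin]
    exact (((integrableOn_Ioi_comp_rpow_iff'
      (fun u : ℝ => u ^ ((k : ℝ) / 2 - 1) * g u) two_ne_zero).2 hg.integrable).congr_fun key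
      measurableSet_Ioi)
  · rw [integral_fun_norm_addHaar volume (f := fun y => g (y ^ 2)), finrank_euclideanSpace,
      Fintype.card_fin, nsmul_eq_mul, smul_eq_mul]
    have h1 : 0 < ∫ y in Ioi (0 : ℝ), y ^ (k - 1) • g (y ^ 2) := by
      rw [← setIntegral_congr_fun measurableSet_Ioi key]
      have h2 := integral_comp_rpow_Ioi_of_pos
        (g := fun u : ℝ => u ^ ((k : ℝ) / 2 - 1) * g u) two_pos
      simp_rw [mul_smul] at h2
      rw [integral_smul] at h2
      have h3 := hg.pos
      rw [← h2, smul_eq_mul] at h3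
      linarith
    have h4 : 0 < (volume : Measure (EuclideanSpace ℝ (Fin k))).real (Metric.ball 0 1) :=
      ENNReal.toReal_pos (Metric.measure_ball_pos _ _ one_pos).ne' measure_ball_lt_top.ne
    positivity

theorem normConst_eq (k : ℕ) (g : ℝ → ℝ) :
    normConst k g = (∫ z : EuclideanSpace ℝ (Fin k), g (‖z‖ ^ 2))⁻¹ := by
  rw [normConst, ← (EuclideanSpace.volume_preserving_symm_measurableEquiv_toLp
    (Fin k)).integral_comp (MeasurableEquiv.measurableEmbedding _)]
  simp_rw [← dotProduct_self_ofLp]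
  rfl

theorem IsDensityGenerator.normConst_pos {k : ℕ} {g : ℝ → ℝ} (hk : 1 ≤ k)
    (hg : IsDensityGenerator k g) : 0 < normConst k g := by
  rw [normConst_eq]
  exact inv_pos.2 (hg.integrable_norm hk).2

/-- The spherical law of `ℝᵏ` with generator `g`. -/
def sphericalLaw (k : ℕ) (g : ℝ → ℝ) : Measure (EuclideanSpace ℝ (Fin k)) :=
  volume.withDensity fun z => ENNReal.ofReal (normConst k g * g (‖z‖ ^ 2))

theorem IsDensityGenerator.isProbabilityMeasure_sphericalLaw {k : ℕ} {g : ℝ → ℝ} (hk : 1 ≤ k)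
    (hg : IsDensityGenerator k g) : IsProbabilityMeasure (sphericalLaw k g) := by
  constructor
  rw [sphericalLaw, withDensity_apply _ .univ, setLIntegral_univ,
    ← ofReal_integral_eq_lintegral_ofReal ((hg.integrable_norm hk).1.const_mul _)
      (.of_forall fun z => mul_nonneg (hg.normConst_pos hk).le (hg.nonneg _ (sq_nonneg _))),
    integral_const_mul, normConst_eq, inv_mul_cancel₀ (hg.integrable_norm hk).2.ne',
    ENNReal.ofReal_one]

instance (n : ℕ) (g : ℝ → ℝ) : SFinite (radialLaw n g) := by
  unfold radialLaw
  infer_instance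

/-- The spherical law is the law of `R₀ U` for independent `R₀`, `U` with the radial law and
the uniform law on the sphere. -/
theorem IsDensityGenerator.map_smul_radialLaw_prod {n : ℕ} {g : ℝ → ℝ}
    (hg : IsDensityGenerator (n + 1) g) :
    ((radialLaw n g).prod (uniformSphere (n + 1))).map (fun p => p.1 • p.2) =
      sphericalLaw (n + 1) g := by
  have := isProbabilityMeasure_uniformSphere (Nat.le_add_left 1 n)
  have hgm := hg.measurable
  refine Measure.ext_of_lintegral _ fun f hf => ?_
  have hsm : Measurable fun p : ℝ × EuclideanSpace ℝ (Fin (n + 1)) => p.1 • p.2 := by fun_prop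
  rw [lintegral_map hf hsm, lintegral_prod_symm (fun p => f (p.1 • p.2)) (hf.comp hsm).aemeasurable, sphericalLaw,
    lintegral_withDensity_eq_lintegral_mul _ (by fun_prop) hf]
  simp only [Pi.mul_apply]
  rw [lintegral_eq_uniformSphere (Nat.le_add_left 1 n) (by fun_prop),
    ← lintegral_const_mul' _ _ (sphereArea_ne_top _)]
  -- On the sphere `‖r u‖ = r` for `r > 0`, so both radial integrands carry `rⁿ g(r²)`. The area of
  -- the sphere supplies the remaining constant of the radial density.
  refine lintegral_congr_ae ?_
  filter_upwards [norm_eq_one_ae_uniformSphere (n + 1)] with u hu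
  rw [radialLaw, lintegral_withDensity_eq_lintegral_mul _ (by fun_prop) (by fun_prop),
    ← lintegral_const_mul' _ _ (sphereArea_ne_top _)]
  refine setLIntegral_congr_fun measurableSet_Ioi fun r hr => ?_
  have hr' : (0 : ℝ) < r := hr
  have hc := (hg.normConst_pos (Nat.le_add_left 1 n)).le
  have hG : 0 < Real.Gamma (((n : ℝ) + 1) / 2) := Real.Gamma_pos_of_pos (by positivity)
  have := Real.pi_pos
  simp only [Pi.mul_apply, norm_smul, hu, mul_one, Real.norm_eq_abs, sq_abs,
    Nat.add_sub_cancel]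
  rw [sphereArea_eq (Nat.le_add_left 1 n), ← mul_assoc, ← mul_assoc,
    ← ENNReal.ofReal_mul (by positivity), ← ENNReal.ofReal_mul (by positivity)]
  push_cast
  ring_nf

/-- Push-forward preserves mass, and the spherical law and the uniform law on the sphere have mass
one, so the radial factor must too. -/
theorem IsDensityGenerator.isProbabilityMeasure_radialLaw {n : ℕ} {g : ℝ → ℝ}
    (hg : IsDensityGenerator (n + 1) g) : IsProbabilityMeasure (radialLaw n g) := by
  have := isProbabilityMeasure_uniformSphere (Nat.le_add_left 1 n)
  have h := hg.isProbabilityMeasure_sphericalLaw (Nat.le_add_left 1 n)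
  rw [← hg.map_smul_radialLaw_prod, Measure.isProbabilityMeasure_map_iff (by fun_prop)] at h
  constructor
  have h1 := h.measure_univ
  rwa [← univ_prod_univ, Measure.prod_prod, measure_univ (μ := uniformSphere (n + 1)),
    mul_one] at h1

end SkewElliptical

end

/-! ### Splitting a uniform vector on the sphere: the beta law. -/

open scoped ENNReal in
theorem lintegral_Ioi_comp_mul_left (f : ℝ → ℝ≥0∞) {c : ℝ} (hc : 0 < c) :
    ∫⁻ x in Ioi (0 : ℝ), f x = ENNReal.ofReal c * ∫⁻ x in Ioi (0 : ℝ), f (c * x) := by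
  have h := lintegral_image_eq_lintegral_abs_deriv_mul (s := Ioi (0 : ℝ)) (f := fun x => c * x)
    (f' := fun _ => c) measurableSet_Ioi
    (fun x _ => by simpa using ((hasDerivAt_id x).const_mul c).hasDerivWithinAt)
    (fun x _ y _ hxy => mul_left_cancel₀ hc.ne' hxy) f
  have himg : (fun x => c * x) '' Ioi (0 : ℝ) = Ioi 0 := by
    rw [Set.image_mul_left_Ioi hc, mul_zero]
  rw [himg, abs_of_pos hc, lintegral_const_mul' _ _ ENNReal.ofReal_ne_top] at h
  exact h

noncomputable section

namespace SkewElliptical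

open scoped ENNReal

@[fun_prop]
theorem measurable_tailVec {n : ℕ} : Measurable (tailVec (n := n)) := by
  unfold tailVec
  fun_prop

theorem lintegral_prod_eq_euclideanSpace_succ {n : ℕ} (f : ℝ × (Fin n → ℝ) → ℝ≥0∞) :
    ∫⁻ z : EuclideanSpace ℝ (Fin (n + 1)), f (z 0, tailVec z) = ∫⁻ p, f p := by
  have h := (volume_preserving_piFinSuccAbove (fun _ : Fin (n + 1) => ℝ) 0).lintegral_comp_emb
    (MeasurableEquiv.measurableEmbedding _) f
  rw [← h, ← lintegral_ofLp]
  rfl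

theorem lintegral_euclideanSpace_fin_one (f : ℝ → ℝ≥0∞) :
    ∫⁻ z : EuclideanSpace ℝ (Fin 1), f (z 0) = ∫⁻ x, f x := by
  have h := (volume_preserving_funUnique (Fin 1) ℝ).lintegral_comp_emb
    (MeasurableEquiv.measurableEmbedding _) f
  exact (lintegral_ofLp (fun x : Fin 1 → ℝ => f (MeasurableEquiv.funUnique (Fin 1) ℝ x))).trans h

/-- The change of variables `t = 1 / (1 + y²)` for the beta law. -/
theorem lintegral_betaMeasure_half {n : ℕ} (hn : 1 ≤ n) {H : ℝ → ℝ≥0∞} (hH : Measurable H) :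
    ∫⁻ t, H t ∂betaMeasure (1 / 2) ((n : ℝ) / 2) =
      ENNReal.ofReal (2 / beta (1 / 2) ((n : ℝ) / 2)) * ∫⁻ y in Ioi (0 : ℝ),
        ENNReal.ofReal (y ^ (n - 1) * √(1 + y ^ 2) ^ (-((n : ℝ) + 1))) * H (1 / (1 + y ^ 2)) := by
  have hn' : (0 : ℝ) < n := by exact_mod_cast hn
  have hB := beta_pos (α := 1 / 2) (β := (n : ℝ) / 2) (by norm_num) (by positivity)
  have himg : (fun y : ℝ => 1 / (1 + y ^ 2)) '' Ioi 0 = Ioo 0 1 := by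
    ext t
    constructor
    · rintro ⟨y, hy, rfl⟩
      have hy' : (0 : ℝ) < y := hy
      have : 0 < y ^ 2 := by positivity
      exact ⟨by positivity, by rw [div_lt_one (by positivity)]; linarith⟩
    · rintro ⟨h0, h1⟩
      have : 0 < 1 / t - 1 := by rw [sub_pos, lt_div_iff₀ h0]; linarith
      refine ⟨√(1 / t - 1), Real.sqrt_pos.2 this, ?_⟩
      simp only
      rw [Real.sq_sqrt this.le]
      field_simp
      ring
  have hderiv : ∀ y ∈ Ioi (0 : ℝ), HasDerivWithinAt (fun y : ℝ => 1 / (1 + y ^ 2))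
      (-(2 * y) / (1 + y ^ 2) ^ 2) (Ioi 0) y := by
    intro y _
    have h1 : (1 + y ^ 2 : ℝ) ≠ 0 := by positivity
    have h2 : HasDerivAt (fun y : ℝ => 1 + y ^ 2) (2 * y) y := by
      simpa using (hasDerivAt_pow 2 y).const_add 1
    simp only [one_div]
    exact (h2.inv h1).hasDerivWithinAt
  have hinj : InjOn (fun y : ℝ => 1 / (1 + y ^ 2)) (Ioi 0) := by
    intro x hx y hy hxy
    have hx' : (0 : ℝ) < x := hx
    have hy' : (0 : ℝ) < y := hy
    simp only [one_div, _root_.inv_inj, add_right_inj] at hxy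
    exact (pow_left_inj₀ hx'.le hy'.le two_ne_zero).1 hxy
  have hpdf : Measurable (betaPDF (1 / 2) ((n : ℝ) / 2)) :=
    (measurable_betaPDFReal _ _).ennreal_ofReal
  have hsupp : ∫⁻ t, betaPDF (1 / 2) ((n : ℝ) / 2) t * H t =
      ∫⁻ t in Ioo 0 1, betaPDF (1 / 2) ((n : ℝ) / 2) t * H t := by
    rw [← lintegral_indicator measurableSet_Ioo]
    refine lintegral_congr fun t => ?_
    by_cases ht : t ∈ Ioo (0 : ℝ) 1
    · rw [indicator_of_mem ht]
    · rw [indicator_of_notMem ht, betaPDF_eq,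
        if_neg (show ¬(0 < t ∧ t < 1) from ht), ENNReal.ofReal_zero, zero_mul]
  rw [betaMeasure, lintegral_withDensity_eq_lintegral_mul _ hpdf hH]
  simp only [Pi.mul_apply]
  rw [hsupp, ← himg, lintegral_image_eq_lintegral_abs_deriv_mul measurableSet_Ioi hderiv hinj,
    ← lintegral_const_mul' _ _ ENNReal.ofReal_ne_top]
  refine setLIntegral_congr_fun measurableSet_Ioi fun y hy => ?_
  have hy' : (0 : ℝ) < y := hy
  have hs : (0 : ℝ) < 1 + y ^ 2 := by positivity
  have ht : 1 / (1 + y ^ 2) ∈ Ioo (0 : ℝ) 1 := himg ▸ mem_image_of_mem _ hy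
  rw [betaPDF_of_pos_lt_one ht.1 ht.2, ← mul_assoc, ← mul_assoc,
    ← ENNReal.ofReal_mul (abs_nonneg _), ← ENNReal.ofReal_mul (by positivity)]
  congr 2
  have h1 : 1 - 1 / (1 + y ^ 2) = y ^ 2 / (1 + y ^ 2) := by field_simp; ring
  have h2 : (y ^ 2 : ℝ) ^ ((n : ℝ) / 2 - 1) = y ^ (n - 1) / y := by
    rw [← Real.rpow_natCast y 2, ← Real.rpow_mul hy'.le, ← Real.rpow_natCast y (n - 1),
      Nat.cast_sub hn, eq_div_iff hy'.ne', ← Real.rpow_add_one hy'.ne']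
    congr 1
    push_cast
    ring
  have h3 : √(1 + y ^ 2) ^ (-((n : ℝ) + 1)) =
      ((1 + y ^ 2) ^ 2)⁻¹ * ((1 + y ^ 2) ^ (1 / 2 - 1 : ℝ))⁻¹ *
        ((1 + y ^ 2) ^ ((n : ℝ) / 2 - 1))⁻¹ := by
    rw [Real.sqrt_eq_rpow, ← Real.rpow_mul hs.le, ← Real.rpow_natCast (1 + y ^ 2) 2, ← Real.rpow_neg hs.le,
      ← Real.rpow_neg hs.le, ← Real.rpow_neg hs.le, ← Real.rpow_add hs, ← Real.rpow_add hs]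
    congr 1
    push_cast
    ring
  rw [h1, Real.div_rpow (sq_nonneg y) hs.le, Real.div_rpow zero_le_one hs.le, Real.one_rpow,
    h2, h3, abs_div, abs_neg, abs_of_pos (by positivity : 0 < 2 * y),
    abs_of_pos (by positivity : 0 < (1 + y ^ 2) ^ 2)]
  field_simp

/-- The squared cosine of the angle in the quadrant, weighted by `ρ₂ⁿ⁻¹ dρ₁ dρ₂` and a radial
weight, has a beta law up to a constant. -/
theorem exists_lintegral_quadrant_eq_betaMeasure {n : ℕ} (hn : 1 ≤ n) {φ : ℝ → ℝ≥0∞}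
    (hφ : Measurable φ) : ∃ C : ℝ≥0∞, ∀ H : ℝ → ℝ≥0∞, Measurable H →
      ∫⁻ a in Ioi (0 : ℝ), (∫⁻ b in Ioi (0 : ℝ), ENNReal.ofReal (b ^ (n - 1)) *
        (φ √(a ^ 2 + b ^ 2) * H (a ^ 2 / (a ^ 2 + b ^ 2)))) =
      C * ∫⁻ t, H t ∂betaMeasure (1 / 2) ((n : ℝ) / 2) := by
  have hn' : (0 : ℝ) < n := by exact_mod_cast hn
  have hB := beta_pos (α := 1 / 2) (β := (n : ℝ) / 2) (by norm_num) (by positivity)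
  set K := ∫⁻ r in Ioi (0 : ℝ), ENNReal.ofReal (r ^ n) * φ r
  refine ⟨K * ENNReal.ofReal (beta (1 / 2) ((n : ℝ) / 2) / 2), fun H hH => ?_⟩
  rw [lintegral_betaMeasure_half hn hH, ← mul_assoc, mul_assoc K, ← ENNReal.ofReal_mul
    (by positivity), div_mul_div_cancel₀ two_ne_zero, div_self hB.ne', ENNReal.ofReal_one, mul_one]
  -- Substituting `b = a y` makes the argument of `H` depend on `y` alone, so the `a`-integral can
  -- be done first after swapping.
  have h1 : ∀ a ∈ Ioi (0 : ℝ), (∫⁻ b in Ioi (0 : ℝ), ENNReal.ofReal (b ^ (n - 1)) *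
        (φ √(a ^ 2 + b ^ 2) * H (a ^ 2 / (a ^ 2 + b ^ 2)))) =
      ∫⁻ y in Ioi (0 : ℝ), ENNReal.ofReal (a ^ n) * φ (√(1 + y ^ 2) * a) *
        (ENNReal.ofReal (y ^ (n - 1)) * H (1 / (1 + y ^ 2))) := by
    intro a ha
    have ha' : (0 : ℝ) < a := ha
    rw [lintegral_Ioi_comp_mul_left _ ha', ← lintegral_const_mul' _ _ ENNReal.ofReal_ne_top]
    refine setLIntegral_congr_fun measurableSet_Ioi fun y hy => ?_
    have hy' : (0 : ℝ) < y := hy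
    have e1 : a ^ 2 + (a * y) ^ 2 = (1 + y ^ 2) * a ^ 2 := by ring
    have e2 : a ^ 2 / (a ^ 2 + (a * y) ^ 2) = 1 / (1 + y ^ 2) := by rw [e1]; field_simp
    have e3 : a * (a * y) ^ (n - 1) = a ^ n * y ^ (n - 1) := by
      rw [mul_pow, ← mul_assoc, ← pow_succ', Nat.sub_add_cancel hn]
    rw [e2, e1, Real.sqrt_mul (by positivity), Real.sqrt_sq ha'.le, ← mul_assoc,
      ← ENNReal.ofReal_mul ha'.le, e3, ENNReal.ofReal_mul (by positivity)]
    ring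
  rw [setLIntegral_congr_fun measurableSet_Ioi h1,
    lintegral_lintegral_swap (by fun_prop),
    ← lintegral_const_mul _ (by fun_prop)]
  refine setLIntegral_congr_fun measurableSet_Ioi fun y hy => ?_
  have hs : 0 < √(1 + y ^ 2) := by positivity
  -- Rescaling `r = √(1 + y²) a` in `K` yields `n` powers from `rⁿ` and one from `dr`. Their inverse
  -- is the weight of the beta law in the variable `y`.
  have hK : K = ENNReal.ofReal (√(1 + y ^ 2) ^ (n + 1)) *
      ∫⁻ a in Ioi (0 : ℝ), ENNReal.ofReal (a ^ n) * φ (√(1 + y ^ 2) * a) := by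
    rw [show K = _ from lintegral_Ioi_comp_mul_left _ hs,
      ← lintegral_const_mul' _ _ ENNReal.ofReal_ne_top,
      ← lintegral_const_mul' _ _ ENNReal.ofReal_ne_top]
    refine setLIntegral_congr_fun measurableSet_Ioi fun a ha => ?_
    rw [mul_pow, ENNReal.ofReal_mul (by positivity), pow_succ √(1 + y ^ 2),
      ENNReal.ofReal_mul (by positivity)]
    ring
  have hy' : (0 : ℝ) < y := hy
  rw [lintegral_mul_const _ (by fun_prop), hK, ENNReal.ofReal_mul (by positivity),
    Real.rpow_neg hs.le, ENNReal.ofReal_inv_of_pos (by positivity)]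
  have : √(1 + y ^ 2) ^ ((n : ℝ) + 1) = √(1 + y ^ 2) ^ (n + 1) := by
    exact_mod_cast Real.rpow_natCast √(1 + y ^ (2 : ℕ)) (n + 1)
  rw [this]
  set w := ENNReal.ofReal (√(1 + y ^ 2) ^ (n + 1))
  set I := ∫⁻ a in Ioi (0 : ℝ), ENNReal.ofReal (a ^ n) * φ (√(1 + y ^ 2) * a)
  have hw0 : w ≠ 0 := by
    have : 0 < √(1 + y ^ 2) ^ (n + 1) := by positivity
    exact (ENNReal.ofReal_pos.2 this).ne'
  rw [show w * I * (ENNReal.ofReal (y ^ (n - 1)) * w⁻¹ * H (1 / (1 + y ^ 2))) =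
    w * w⁻¹ * (I * (ENNReal.ofReal (y ^ (n - 1)) * H (1 / (1 + y ^ 2)))) by ring,
    ENNReal.mul_inv_cancel hw0 ENNReal.ofReal_ne_top, one_mul]

/-- The first coordinate and the others of a uniform vector on the sphere of `ℝⁿ⁺¹`: a beta
mixture of uniform vectors on the spheres of `ℝ` and `ℝⁿ`. -/
theorem map_uniformSphere_succ {n : ℕ} (hn : 1 ≤ n) :
    (uniformSphere (n + 1)).map (fun u => (u 0, tailVec u)) =
      ((betaMeasure (1 / 2) ((n : ℝ) / 2)).prod
        ((uniformSphere 1).prod (uniformSphere n))).map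
          (fun p => (√p.1 * p.2.1 0, √(1 - p.1) • p.2.2.ofLp)) := by
  have hn' : (0 : ℝ) < n := by exact_mod_cast hn
  have := isProbabilityMeasure_uniformSphere (Nat.le_add_left 1 n)
  have := isProbabilityMeasure_uniformSphere hn
  have := isProbabilityMeasure_uniformSphere (le_refl 1)
  have := isProbabilityMeasureBeta (α := 1 / 2) (β := (n : ℝ) / 2) (by norm_num) (by positivity)
  have hm1 : Measurable fun u : EuclideanSpace ℝ (Fin (n + 1)) => (u 0, tailVec u) := by
    fun_prop
  have hm2 : Measurable fun p : ℝ × EuclideanSpace ℝ (Fin 1) × EuclideanSpace ℝ (Fin n) =>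
      (√p.1 * p.2.1 0, √(1 - p.1) • p.2.2.ofLp) := by fun_prop
  set μ := (uniformSphere (n + 1)).map (fun u => (u 0, tailVec u))
  set ν := ((betaMeasure (1 / 2) ((n : ℝ) / 2)).prod
    ((uniformSphere 1).prod (uniformSphere n))).map
      (fun p => (√p.1 * p.2.1 0, √(1 - p.1) • p.2.2.ofLp))
  have : IsProbabilityMeasure μ := Measure.isProbabilityMeasure_map hm1.aemeasurable
  have : IsProbabilityMeasure ν := Measure.isProbabilityMeasure_map hm2.aemeasurable
  -- A radial cutoff to the unit ball makes the integrals below finite and nonzero.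
  set φ : ℝ → ℝ≥0∞ := (Iic (1 : ℝ)).indicator 1
  have hφ : Measurable φ := measurable_one.indicator measurableSet_Iic
  obtain ⟨C, hC⟩ := exists_lintegral_quadrant_eq_betaMeasure hn hφ
  set N : ℝ × (Fin n → ℝ) → ℝ := fun p => √(p.1 ^ 2 + p.2 ⬝ᵥ p.2) with hN
  have hNm : Measurable N := by
    simp only [hN, dotProduct]
    fun_prop
  set K := ∫⁻ r in Ioi (0 : ℝ), ENNReal.ofReal (r ^ n) * φ r with hKdef
  have norm_eq : ∀ z : EuclideanSpace ℝ (Fin (n + 1)), N (z 0, tailVec z) = ‖z‖ := by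
    intro z
    rw [EuclideanSpace.norm_eq]
    simp [hN, tailVec, Fin.sum_univ_succ, dotProduct, sq]
  -- The function `h` on the sphere is extended as homogeneous of degree zero and integrated over
  -- the ball. Polar coordinates of `ℝⁿ⁺¹` give a multiple of the `μ`-integral. Polar coordinates of
  -- `ℝ` and `ℝⁿ` separately leave a quadrant integral in the two radii, hence a multiple of the
  -- `ν`-integral.
  set L : (ℝ × (Fin n → ℝ) → ℝ≥0∞) → ℝ≥0∞ := fun h => ∫⁻ p, φ (N p) * h ((N p)⁻¹ • p) with hL
  have lhs : ∀ h : ℝ × (Fin n → ℝ) → ℝ≥0∞, Measurable h →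
      L h = sphereArea (n + 1) * K * ∫⁻ p, h p ∂μ := by
    intro h hh
    have hm : Measurable fun z : EuclideanSpace ℝ (Fin (n + 1)) =>
        φ ‖z‖ * h (‖z‖⁻¹ • (z 0, tailVec z)) := by fun_prop
    rw [hL]
    simp only
    rw [← lintegral_prod_eq_euclideanSpace_succ]
    simp only [norm_eq]
    rw [lintegral_eq_uniformSphere (Nat.le_add_left 1 n) hm, mul_assoc,
      lintegral_map hh hm1]
    congr 1
    rw [← lintegral_const_mul _ (by fun_prop)]
    refine lintegral_congr_ae ?_
    filter_upwards [norm_eq_one_ae_uniformSphere (n + 1)] with u hu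
    rw [mul_comm K, hKdef, ← lintegral_const_mul _ (by fun_prop)]
    refine setLIntegral_congr_fun measurableSet_Ioi fun r hr => ?_
    have hr' : (0 : ℝ) < r := hr
    have e : r⁻¹ • ((r • u) 0, tailVec (r • u)) = (u 0, tailVec u) := by
      ext
      · simp [hr'.ne']
      · simp [tailVec, hr'.ne']
    simp only [norm_smul, hu, mul_one, Real.norm_eq_abs, abs_of_pos hr', Nat.add_sub_cancel]
    rw [e]
    ring
  have rhs : ∀ h : ℝ × (Fin n → ℝ) → ℝ≥0∞, Measurable h →
      L h = sphereArea 1 * sphereArea n * C * ∫⁻ p, h p ∂ν := by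
    intro h hh
    have hGm : Measurable fun p => φ (N p) * h ((N p)⁻¹ • p) := by fun_prop
    have e : L h = ∫⁻ x : EuclideanSpace ℝ (Fin 1), ∫⁻ y : EuclideanSpace ℝ (Fin n),
        φ (N (x 0, y.ofLp)) * h ((N (x 0, y.ofLp))⁻¹ • (x 0, y.ofLp)) := by
      rw [hL]
      simp only
      rw [Measure.volume_eq_prod, lintegral_prod _ hGm.aemeasurable,
        ← lintegral_euclideanSpace_fin_one]
      refine lintegral_congr fun x => ?_
      rw [← lintegral_ofLp]
    have polar : L h = sphereArea 1 * (sphereArea n * ∫⁻ v, (∫⁻ w, (∫⁻ a in Ioi (0 : ℝ),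
        (∫⁻ b in Ioi (0 : ℝ), ENNReal.ofReal (b ^ (n - 1)) * (φ (N (a * v 0, b • w.ofLp)) *
          h ((N (a * v 0, b • w.ofLp))⁻¹ • (a * v 0, b • w.ofLp))))) ∂uniformSphere n)
            ∂uniformSphere 1) := by
      rw [e, lintegral_eq_uniformSphere (le_refl 1) (Measurable.lintegral_prod_right'
        (f := fun p : EuclideanSpace ℝ (Fin 1) × EuclideanSpace ℝ (Fin n) =>
          φ (N (p.1 0, p.2.ofLp)) * h ((N (p.1 0, p.2.ofLp))⁻¹ • (p.1 0, p.2.ofLp)))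
            (by fun_prop)), ← lintegral_const_mul' _ _ (sphereArea_ne_top n)]
      congr 1
      refine lintegral_congr fun v => ?_
      rw [← lintegral_lintegral_swap (by fun_prop),
        ← lintegral_const_mul' _ _ (sphereArea_ne_top n)]
      refine lintegral_congr fun a => ?_
      rw [lintegral_eq_uniformSphere hn (by fun_prop)]
      simp
    have inner : ∀ᵐ v ∂uniformSphere 1, ∀ᵐ w ∂uniformSphere n, (∫⁻ a in Ioi (0 : ℝ),
        (∫⁻ b in Ioi (0 : ℝ), ENNReal.ofReal (b ^ (n - 1)) * (φ (N (a * v 0, b • w.ofLp)) *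
          h ((N (a * v 0, b • w.ofLp))⁻¹ • (a * v 0, b • w.ofLp))))) =
        C * ∫⁻ t, h (√t * v 0, √(1 - t) • w.ofLp) ∂betaMeasure (1 / 2) ((n : ℝ) / 2) := by
      filter_upwards [norm_eq_one_ae_uniformSphere 1] with v hv
      filter_upwards [norm_eq_one_ae_uniformSphere n] with w hw
      rw [← hC _ (by fun_prop)]
      refine setLIntegral_congr_fun measurableSet_Ioi fun a ha => ?_
      refine setLIntegral_congr_fun measurableSet_Ioi fun b hb => ?_
      have ha' : (0 : ℝ) < a := ha
      have hb' : (0 : ℝ) < b := hb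
      have hv2 : v 0 ^ 2 = 1 := by
        have := EuclideanSpace.real_norm_sq_eq v
        rw [hv] at this
        simpa using this.symm
      have hNab : N (a * v 0, b • w.ofLp) = √(a ^ 2 + b ^ 2) := by
        simp only [hN, dotProduct_smul, smul_dotProduct, dotProduct_self_ofLp, hw, mul_pow, hv2,
          smul_eq_mul]
        ring_nf
      have h1 : 1 - a ^ 2 / (a ^ 2 + b ^ 2) = b ^ 2 / (a ^ 2 + b ^ 2) := by field_simp; ring
      rw [hNab, h1, Real.sqrt_div (sq_nonneg a), Real.sqrt_div (sq_nonneg b), Real.sqrt_sq ha'.le,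
        Real.sqrt_sq hb'.le]
      congr 3
      ext
      · simp only [Prod.smul_mk, smul_eq_mul]
        ring
      · simp only [Prod.smul_mk, Pi.smul_apply, smul_eq_mul]
        ring
    rw [polar, lintegral_map hh hm2, lintegral_prod_symm
      (fun p : ℝ × EuclideanSpace ℝ (Fin 1) × EuclideanSpace ℝ (Fin n) =>
        h (√p.1 * p.2.1 0, √(1 - p.1) • p.2.2.ofLp)) (hh.comp hm2).aemeasurable,
      lintegral_prod _ (by fun_prop), mul_assoc, mul_assoc]
    congr 2
    rw [← lintegral_const_mul _ (by fun_prop)]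
    refine lintegral_congr_ae ?_
    filter_upwards [inner] with v hv
    rw [lintegral_congr_ae hv, lintegral_const_mul _ (by fun_prop)]
  have pos : L 1 ≠ 0 ∧ L 1 ≠ ∞ := by
    have e : L 1 = volume (Metric.closedBall (0 : EuclideanSpace ℝ (Fin (n + 1))) 1) := by
      rw [hL]
      simp only
      rw [← lintegral_prod_eq_euclideanSpace_succ, ← lintegral_indicator_one
        Metric.isClosed_closedBall.measurableSet]
      refine lintegral_congr fun z => ?_
      simp [norm_eq, φ, indicator]
    rw [e]
    exact ⟨(Metric.measure_closedBall_pos _ _ one_pos).ne', measure_closedBall_lt_top.ne⟩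
  -- Since `μ` and `ν` are probability measures, `h = 1` shows that both multiples equal `L 1`, so
  -- no constant has to be computed.
  have h1 := lhs 1 measurable_one
  have h2 := rhs 1 measurable_one
  simp only [Pi.one_apply, lintegral_const, measure_univ, mul_one] at h1 h2
  refine Measure.ext_of_lintegral _ fun h hh => ?_
  have h3 := (lhs h hh).symm.trans (rhs h hh)
  rw [← h1, ← h2] at h3
  exact (ENNReal.mul_right_inj pos.1 pos.2).1 h3

end SkewElliptical

end

/-! ### Existence and uniqueness of the parameters `(δ, Ψ)`. -/

theorem Matrix.inv_diagonal_of_ne_zero {ι K : Type*} [Fintype ι] [DecidableEq ι] [Field K]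
    {d : ι → K} (hd : ∀ i, d i ≠ 0) : (diagonal d)⁻¹ = diagonal fun i => (d i)⁻¹ := by
  refine Matrix.inv_eq_right_inv ?_
  rw [diagonal_mul_diagonal, ← diagonal_one]
  congr 1
  ext i
  exact mul_inv_cancel₀ (hd i)

/-- The Cauchy–Schwarz inequality for a positive definite matrix. -/
theorem Matrix.PosDef.sq_dotProduct_mulVec_le {ι : Type*} [Fintype ι] {R : Matrix ι ι ℝ}
    (hR : R.PosDef) (x y : ι → ℝ) :
    (x ⬝ᵥ (R *ᵥ y)) ^ 2 ≤ (x ⬝ᵥ (R *ᵥ x)) * (y ⬝ᵥ (R *ᵥ y)) := by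
  have hsymm : y ⬝ᵥ (R *ᵥ x) = x ⬝ᵥ (R *ᵥ y) := by
    have ht : Rᵀ = R := hR.isHermitian
    rw [dotProduct_comm, dotProduct_mulVec, ← mulVec_transpose, ht]
  have h : ∀ t : ℝ, 0 ≤ (y ⬝ᵥ (R *ᵥ y)) * (t * t) + (2 * (x ⬝ᵥ (R *ᵥ y))) * t +
      x ⬝ᵥ (R *ᵥ x) := by
    intro t
    have h := hR.posSemidef.dotProduct_mulVec_nonneg (x + t • y)
    simp only [star_trivial, mulVec_add, mulVec_smul, dotProduct_add, add_dotProduct,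
      dotProduct_smul, smul_dotProduct, smul_eq_mul, hsymm] at h
    linarith
  have := discrim_le_zero h
  rw [discrim] at this
  linarith

noncomputable section

namespace SkewElliptical

section Parameters

variable {n : ℕ} {Om Psi : Matrix (Fin n) (Fin n) ℝ} {α δ : Fin n → ℝ}

theorem sqrt_one_sub_sq_pos {t : ℝ} (ht : t ∈ Ioo (-1 : ℝ) 1) : 0 < √(1 - t ^ 2) :=
  Real.sqrt_pos.2 (by nlinarith [ht.1, ht.2])

theorem scaleMatrix_inv (hOm : Om.PosDef) :
    (scaleMatrix Om)⁻¹ = diagonal fun i => (√(Om i i))⁻¹ :=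
  inv_diagonal_of_ne_zero fun _ => (Real.sqrt_pos.2 hOm.diag_pos).ne'

theorem deltaMatrix_inv (hδ : ∀ i, δ i ∈ Ioo (-1 : ℝ) 1) :
    (deltaMatrix δ)⁻¹ = diagonal fun i => (√(1 - δ i ^ 2))⁻¹ :=
  inv_diagonal_of_ne_zero fun i => (sqrt_one_sub_sq_pos (hδ i)).ne'

theorem isUnit_det_scaleMatrix (hOm : Om.PosDef) : IsUnit (scaleMatrix Om).det := by
  rw [scaleMatrix, det_diagonal, isUnit_iff_ne_zero]
  exact Finset.prod_ne_zero_iff.2 fun i _ => (Real.sqrt_pos.2 hOm.diag_pos).ne'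

theorem isUnit_det_deltaMatrix (hδ : ∀ i, δ i ∈ Ioo (-1 : ℝ) 1) :
    IsUnit (deltaMatrix δ).det := by
  rw [deltaMatrix, det_diagonal, isUnit_iff_ne_zero]
  exact Finset.prod_ne_zero_iff.2 fun i _ => (sqrt_one_sub_sq_pos (hδ i)).ne'

theorem deltaMatrix_mulVec_lam (hδ : ∀ i, δ i ∈ Ioo (-1 : ℝ) 1) :
    deltaMatrix δ *ᵥ lam δ = δ := by
  rw [lam, mulVec_mulVec, mul_nonsing_inv _ (isUnit_det_deltaMatrix hδ), one_mulVec]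

theorem deltaMatrix_transpose : (deltaMatrix δ)ᵀ = deltaMatrix δ := diagonal_transpose _

theorem scaleMatrix_transpose : (scaleMatrix Om)ᵀ = scaleMatrix Om := diagonal_transpose _

/-- Since `Δλ = δ`, the rank-one term loses its `Δ` factors. -/
theorem deltaMatrix_mul_add_mul (hδ : ∀ i, δ i ∈ Ioo (-1 : ℝ) 1) :
    deltaMatrix δ * (Psi + vecMulVec (lam δ) (lam δ)) * deltaMatrix δ =
      deltaMatrix δ * Psi * deltaMatrix δ + vecMulVec δ δ := by
  rw [mul_add, add_mul, mul_vecMulVec, vecMulVec_mul, ← mulVec_transpose, deltaMatrix_transpose,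
    deltaMatrix_mulVec_lam hδ]

theorem corrMatrix_posDef (hOm : Om.PosDef) : (corrMatrix Om).PosDef := by
  have h := hOm.conjTranspose_mul_mul_same (B := (scaleMatrix Om)⁻¹)
    (mulVec_injective_of_isUnit ((isUnit_nonsing_inv_iff).2
      ((isUnit_iff_isUnit_det _).2 (isUnit_det_scaleMatrix hOm))))
  rwa [conjTranspose_eq_transpose_of_trivial, transpose_nonsing_inv, scaleMatrix_transpose] at h

theorem corrMatrix_diag (hOm : Om.PosDef) (i : Fin n) : corrMatrix Om i i = 1 := by
  have h := hOm.diag_pos (i := i)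
  rw [corrMatrix, scaleMatrix_inv hOm, mul_diagonal, diagonal_mul]
  have := Real.sqrt_pos.2 h
  field_simp
  exact (Real.sq_sqrt h.le).symm

theorem scaleMatrix_mul_corrMatrix_mul (hOm : Om.PosDef) :
    scaleMatrix Om * corrMatrix Om * scaleMatrix Om = Om := by
  have h := isUnit_det_scaleMatrix hOm
  rw [corrMatrix, ← mul_assoc, ← mul_assoc, mul_nonsing_inv _ h, one_mul, mul_assoc,
    nonsing_inv_mul _ h, mul_one]

theorem IsSkewParam.one_add_pos (h : IsSkewParam Om α δ Psi) :
    0 < 1 + lam δ ⬝ᵥ (Psi⁻¹ *ᵥ lam δ) := by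
  have := h.posDef.inv.posSemidef.dotProduct_mulVec_nonneg (lam δ)
  rw [star_trivial] at this
  linarith

theorem IsSkewParam.alpha_eq_inv_sqrt_smul (h : IsSkewParam Om α δ Psi) :
    α = (√(1 + lam δ ⬝ᵥ (Psi⁻¹ *ᵥ lam δ)))⁻¹ • ((deltaMatrix δ)⁻¹ *ᵥ (Psi⁻¹ *ᵥ lam δ)) := by
  rw [Real.sqrt_eq_rpow, ← Real.rpow_neg h.one_add_pos.le]
  exact h.alpha_eq

/-- Let `k² = 1 + λ'Ψ⁻¹λ`. Then `ΔΨΔα = δ/k` and `δ'α = (k² - 1)/k`, and the two contributions add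
up to `kδ`. -/
theorem IsSkewParam.corrMatrix_mulVec (h : IsSkewParam Om α δ Psi) :
    corrMatrix Om *ᵥ α = √(1 + lam δ ⬝ᵥ (Psi⁻¹ *ᵥ lam δ)) • δ := by
  have hΔ := isUnit_det_deltaMatrix h.delta_mem
  have hΨ := (isUnit_iff_isUnit_det _).1 h.posDef.isUnit
  have hpos := h.one_add_pos
  have hα := h.alpha_eq_inv_sqrt_smul
  set k2 := 1 + lam δ ⬝ᵥ (Psi⁻¹ *ᵥ lam δ) with hk2
  have e : δ ⬝ᵥ ((deltaMatrix δ)⁻¹ *ᵥ (Psi⁻¹ *ᵥ lam δ)) = lam δ ⬝ᵥ (Psi⁻¹ *ᵥ lam δ) := by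
    rw [dotProduct_mulVec, ← mulVec_transpose, transpose_nonsing_inv, deltaMatrix_transpose]
    rfl
  rw [h.corr_eq, deltaMatrix_mul_add_mul h.delta_mem, hα, mulVec_smul, add_mulVec,
    vecMulVec_mulVec, e, ← mulVec_mulVec, ← mulVec_mulVec, mulVec_mulVec _ (deltaMatrix δ)
    (deltaMatrix δ)⁻¹, mul_nonsing_inv _ hΔ, one_mulVec, mulVec_mulVec _ Psi Psi⁻¹,
    mul_nonsing_inv _ hΨ, one_mulVec, deltaMatrix_mulVec_lam h.delta_mem]
  have hs := Real.sqrt_pos.2 hpos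
  ext i
  simp only [Pi.smul_apply, Pi.add_apply, smul_eq_mul, MulOpposite.smul_eq_mul_unop,
    MulOpposite.unop_op]
  have : lam δ ⬝ᵥ (Psi⁻¹ *ᵥ lam δ) = √k2 ^ 2 - 1 := by rw [Real.sq_sqrt hpos.le, hk2]; ring
  rw [this]
  field_simp
  ring

/-- This recovers the normalizing factor from `Ω` and `α`, so that `δ`, and then `Ψ`, become
explicit functions of the given data. -/
theorem IsSkewParam.one_add_dotProduct (h : IsSkewParam Om α δ Psi) :
    1 + α ⬝ᵥ (corrMatrix Om *ᵥ α) = 1 + lam δ ⬝ᵥ (Psi⁻¹ *ᵥ lam δ) := by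
  have hs := Real.sqrt_pos.2 h.one_add_pos
  rw [h.corrMatrix_mulVec, dotProduct_smul]
  nth_rw 1 [h.alpha_eq_inv_sqrt_smul]
  rw [smul_dotProduct, smul_smul, mul_inv_cancel₀ hs.ne', one_smul, dotProduct_comm,
    dotProduct_mulVec, ← mulVec_transpose, transpose_nonsing_inv, deltaMatrix_transpose]
  rfl

theorem IsSkewParam.delta_eq (h : IsSkewParam Om α δ Psi) :
    δ = (√(1 + α ⬝ᵥ (corrMatrix Om *ᵥ α)))⁻¹ • (corrMatrix Om *ᵥ α) := by
  rw [h.one_add_dotProduct, h.corrMatrix_mulVec, smul_smul,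
    inv_mul_cancel₀ (Real.sqrt_pos.2 h.one_add_pos).ne', one_smul]

theorem IsSkewParam.psi_eq (h : IsSkewParam Om α δ Psi) :
    Psi = (deltaMatrix δ)⁻¹ * (corrMatrix Om - vecMulVec δ δ) * (deltaMatrix δ)⁻¹ := by
  have hΔ := isUnit_det_deltaMatrix h.delta_mem
  rw [h.corr_eq, deltaMatrix_mul_add_mul h.delta_mem, add_sub_cancel_right, mul_assoc, mul_assoc,
    mul_nonsing_inv _ hΔ, mul_one, ← mul_assoc, nonsing_inv_mul _ hΔ, one_mul]

/-- With `R` the correlation matrix and `q = α'Rα`, take the forced values `δ = Rα/√(1 + q)` and `Ψ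
= Δ⁻¹(R - δδ')Δ⁻¹`. Cauchy–Schwarz for `R`, applied to `α` and a basis vector, gives `δᵢ² ≤ q/(1 +
q) < 1`. -/
theorem exists_isSkewParam (hOm : Om.PosDef) (α : Fin n → ℝ) :
    ∃ (δ : Fin n → ℝ) (Psi : Matrix (Fin n) (Fin n) ℝ), IsSkewParam Om α δ Psi := by
  have hR := corrMatrix_posDef hOm
  have hRd := corrMatrix_diag hOm
  set R := corrMatrix Om with hRdef
  have hRt : Rᵀ = R := hR.isHermitian
  have hq : 0 ≤ α ⬝ᵥ (R *ᵥ α) := by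
    simpa using hR.posSemidef.dotProduct_mulVec_nonneg α
  set q := α ⬝ᵥ (R *ᵥ α) with hqdef
  set k := √(1 + q) with hk
  have hk0 : 0 < k := Real.sqrt_pos.2 (by linarith)
  have hk2 : k ^ 2 = 1 + q := Real.sq_sqrt (by linarith)
  set δ : Fin n → ℝ := k⁻¹ • (R *ᵥ α) with hδdef
  have hδ : ∀ i, δ i ∈ Ioo (-1 : ℝ) 1 := by
    intro i
    have h1 := hR.sq_dotProduct_mulVec_le (Pi.single i 1) α
    have h2 : Pi.single i 1 ⬝ᵥ (R *ᵥ Pi.single i 1) = 1 := by simp [hRd i]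
    rw [h2, single_one_dotProduct, one_mul, ← hqdef] at h1
    have h3 : δ i ^ 2 < 1 := by
      simp only [hδdef, Pi.smul_apply, smul_eq_mul]
      rw [mul_pow, inv_pow, inv_mul_lt_iff₀ (by positivity), hk2]
      linarith
    exact ⟨by nlinarith, by nlinarith⟩
  have hΔ := isUnit_det_deltaMatrix hδ
  set Δ := deltaMatrix δ with hΔdef
  -- Cauchy–Schwarz again: `(x'Rα)² ≤ q x'Rx < (1 + q) x'Rx` for `x ≠ 0`.
  have hM : (R - vecMulVec δ δ).PosDef := by
    refine PosDef.of_dotProduct_mulVec_pos ?_ fun x hx => ?_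
    · rw [IsHermitian, conjTranspose_eq_transpose_of_trivial, transpose_sub, hRt,
        transpose_vecMulVec]
    · have h1 := hR.dotProduct_mulVec_pos hx
      have h2 := hR.sq_dotProduct_mulVec_le x α
      rw [star_trivial] at h1 ⊢
      have h3 : x ⬝ᵥ ((R - vecMulVec δ δ) *ᵥ x) =
          x ⬝ᵥ (R *ᵥ x) - (x ⬝ᵥ (R *ᵥ α)) ^ 2 / (1 + q) := by
        rw [sub_mulVec, vecMulVec_mulVec, dotProduct_sub, dotProduct_smul,
          MulOpposite.smul_eq_mul_unop, MulOpposite.unop_op, dotProduct_comm δ x, hδdef,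
          dotProduct_smul, smul_eq_mul, ← hk2]
        field_simp
      rw [h3, sub_pos, div_lt_iff₀ (by linarith)]
      nlinarith
  set Psi := Δ⁻¹ * (R - vecMulVec δ δ) * Δ⁻¹ with hPsi
  have hΔPΔ : Δ * Psi * Δ = R - vecMulVec δ δ := by
    rw [hPsi, ← mul_assoc, ← mul_assoc, mul_nonsing_inv _ hΔ, one_mul, mul_assoc,
      nonsing_inv_mul _ hΔ, mul_one]
  have hPpos : Psi.PosDef := by
    have h := hM.conjTranspose_mul_mul_same (B := Δ⁻¹)
      (mulVec_injective_of_isUnit ((isUnit_nonsing_inv_iff).2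
        ((isUnit_iff_isUnit_det _).2 hΔ)))
    rwa [conjTranspose_eq_transpose_of_trivial, transpose_nonsing_inv, deltaMatrix_transpose] at h
  have hPu := (isUnit_iff_isUnit_det _).1 hPpos.isUnit
  have hδα : δ ⬝ᵥ α = q / k := by
    rw [hδdef, smul_dotProduct, dotProduct_comm, smul_eq_mul, hqdef]
    field_simp
  -- Checked by applying `Ψ`: `(R - δδ')α = kδ - (q/k)δ = δ/k`, so `Ψ(kΔα) = Δ⁻¹δ = λ`.
  have hPl : Psi⁻¹ *ᵥ lam δ = k • (Δ *ᵥ α) := by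
    have h1 : Psi *ᵥ (k • (Δ *ᵥ α)) = lam δ := by
      have h2 : Psi *ᵥ (Δ *ᵥ α) = Δ⁻¹ *ᵥ ((R - vecMulVec δ δ) *ᵥ α) := by
        rw [hPsi, mulVec_mulVec, mulVec_mulVec, mul_assoc, nonsing_inv_mul _ hΔ, mul_one]
      have h3 : (R - vecMulVec δ δ) *ᵥ α = k⁻¹ • δ := by
        rw [sub_mulVec, vecMulVec_mulVec, hδα]
        have h4 : R *ᵥ α = k • δ := by rw [hδdef, smul_smul, mul_inv_cancel₀ hk0.ne', one_smul]
        rw [h4]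
        ext i
        simp only [Pi.smul_apply, Pi.sub_apply, smul_eq_mul, MulOpposite.smul_eq_mul_unop,
          MulOpposite.unop_op]
        have : q = k ^ 2 - 1 := by rw [hk2]; ring
        rw [this]
        field_simp
        ring
      rw [mulVec_smul, h2, h3, mulVec_smul, smul_smul, mul_inv_cancel₀ hk0.ne', one_smul]
      rfl
    rw [← h1, mulVec_mulVec, nonsing_inv_mul _ hPu, one_mulVec]
  have hlPl : 1 + lam δ ⬝ᵥ (Psi⁻¹ *ᵥ lam δ) = 1 + q := by
    rw [hPl, dotProduct_smul, dotProduct_mulVec, ← mulVec_transpose, deltaMatrix_transpose,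
      deltaMatrix_mulVec_lam hδ, hδα, smul_eq_mul, mul_div_cancel₀ _ hk0.ne']
  refine ⟨δ, Psi, hδ, hPpos, fun i => ?_, ?_, ?_⟩
  · have hd := sqrt_one_sub_sq_pos (hδ i)
    rw [hPsi, hΔdef, deltaMatrix_inv hδ, mul_diagonal, diagonal_mul, Matrix.sub_apply, hRd,
      vecMulVec_apply]
    field_simp
    rw [Real.sq_sqrt (Real.sqrt_pos.1 hd).le]
  · rw [deltaMatrix_mul_add_mul hδ, hΔPΔ, sub_add_cancel]
  · rw [hlPl, hPl, Real.rpow_neg (by linarith), ← Real.sqrt_eq_rpow, ← hk, mulVec_smul, smul_smul,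
      inv_mul_cancel₀ hk0.ne', one_smul, mulVec_mulVec, nonsing_inv_mul _ hΔ, one_mulVec]

theorem existsUnique_isSkewParam (hOm : Om.PosDef) (α : Fin n → ℝ) :
    ∃! p : (Fin n → ℝ) × Matrix (Fin n) (Fin n) ℝ, IsSkewParam Om α p.1 p.2 := by
  obtain ⟨δ, Psi, h⟩ := exists_isSkewParam hOm α
  refine ⟨(δ, Psi), h, fun p hp => ?_⟩
  have h1 : p.1 = δ := hp.delta_eq.trans h.delta_eq.symm
  refine Prod.ext h1 ?_
  rw [hp.psi_eq, h1]
  exact h.psi_eq.symm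

end Parameters

end SkewElliptical

end

/-! ### Substitutions in Lebesgue integrals. -/

section LIntegral

open scoped ENNReal

theorem lintegral_comp_mulVec_add {ι : Type*} [Fintype ι] [DecidableEq ι] {A : Matrix ι ι ℝ}
    (hA : A.det ≠ 0) (w : ι → ℝ) {F : (ι → ℝ) → ℝ≥0∞} (hF : Measurable F) :
    ∫⁻ y, F (A *ᵥ y + w) = ENNReal.ofReal |A.det|⁻¹ * ∫⁻ x, F x := by
  have hm : Measurable (toLin' A) := (LinearMap.continuous_of_finiteDimensional _).measurable
  have h := lintegral_map (μ := volume) (f := fun x => F (x + w)) (by fun_prop) hm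
  rw [Real.map_matrix_volume_pi_eq_smul_volume_pi hA, lintegral_smul_measure,
    lintegral_add_right_eq_self F w, abs_inv] at h
  simpa using h.symm

/-- Needed to turn the integral up to the argument of the skewing distribution function into one
over the values `t > 0` of `|Z₁|`. -/
theorem lintegral_Ioi_comp_sub_mul (F : ℝ → ℝ≥0∞) (a : ℝ) {k : ℝ} (hk : 0 < k) :
    ∫⁻ s in Iio a, F s = ENNReal.ofReal k * ∫⁻ t in Ioi (0 : ℝ), F (a - k * t) := by
  have h := lintegral_image_eq_lintegral_abs_deriv_mul (s := Ioi (0 : ℝ))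
    (f := fun t => a - k * t) (f' := fun _ => -k) measurableSet_Ioi
    (fun x _ => by simpa using (((hasDerivAt_id x).const_mul k).const_sub a).hasDerivWithinAt)
    (fun x _ y _ hxy => mul_left_cancel₀ hk.ne' (sub_right_injective hxy)) F
  have himg : (fun t => a - k * t) '' Ioi (0 : ℝ) = Iio a := by
    ext s
    constructor
    · rintro ⟨t, ht, rfl⟩
      have ht' : (0 : ℝ) < t := ht
      have : 0 < k * t := by positivity
      simpa using this
    · intro hs
      have hs' : s < a := hs
      exact ⟨(a - s) / k, div_pos (sub_pos.2 hs') hk, by simp only; field_simp; ring⟩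
  rw [himg, abs_neg, abs_of_pos hk, lintegral_const_mul' _ _ ENNReal.ofReal_ne_top] at h
  exact h

/-- Folding the line at the origin; this is the source of the factor `2` in the skew density. -/
theorem lintegral_comp_abs (F : ℝ → ℝ≥0∞) :
    ∫⁻ t, F |t| = 2 * ∫⁻ t in Ioi (0 : ℝ), F t := by
  have h1 : ∫⁻ t in Iio (0 : ℝ), F |t| = ∫⁻ t in Ioi (0 : ℝ), F t := by
    rw [lintegral_Ioi_comp_sub_mul _ _ one_pos, ENNReal.ofReal_one, one_mul]
    refine setLIntegral_congr_fun measurableSet_Ioi fun t ht => ?_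
    have ht' : (0 : ℝ) < t := ht
    simp [abs_of_pos ht']
  have h2 : ∫⁻ t in Ioi (0 : ℝ), F |t| = ∫⁻ t in Ioi (0 : ℝ), F t :=
    setLIntegral_congr_fun measurableSet_Ioi fun t ht => by rw [abs_of_pos ht]
  rw [← lintegral_add_compl _ measurableSet_Iio, h1, compl_Iio, ← restrict_Ioi_eq_restrict_Ici,
    h2, two_mul]

theorem lintegral_Ioi_comp_sq (F : ℝ → ℝ≥0∞) :
    ∫⁻ r in Ioi (0 : ℝ), F r = ∫⁻ s in Ioi (0 : ℝ), ENNReal.ofReal (2 * s) * F (s ^ 2) := by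
  have h := lintegral_image_eq_lintegral_abs_deriv_mul (s := Ioi (0 : ℝ))
    (f := fun t => t ^ 2) (f' := fun t => 2 * t) measurableSet_Ioi
    (fun x _ => by simpa using (hasDerivAt_pow 2 x).hasDerivWithinAt)
    (fun x (hx : 0 < x) y (hy : 0 < y) hxy => (pow_left_inj₀ hx.le hy.le two_ne_zero).1 hxy) F
  have himg : (fun t : ℝ => t ^ 2) '' Ioi (0 : ℝ) = Ioi 0 := by
    ext s
    constructor
    · rintro ⟨t, ht, rfl⟩
      exact pow_pos (show (0 : ℝ) < t from ht) 2
    · intro hs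
      exact ⟨√s, Real.sqrt_pos.2 hs, Real.sq_sqrt (le_of_lt hs)⟩
  rw [himg] at h
  rw [h]
  refine setLIntegral_congr_fun measurableSet_Ioi fun s hs => ?_
  have hs' : (0 : ℝ) < s := hs
  rw [abs_of_pos (by positivity)]

end LIntegral

/-! ### The skew density as an integral of the generator over a half-line. -/

noncomputable section

namespace SkewElliptical

open scoped ENNReal

variable {n : ℕ} {g : ℝ → ℝ}

/-- The integral of the generator along a line at squared distance `q` of the origin. -/
def lineMass (g : ℝ → ℝ) (q : ℝ) : ℝ≥0∞ := ∫⁻ s : ℝ, ENNReal.ofReal (g (s ^ 2 + q))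

theorem measurable_lineMass (hg : Measurable g) : Measurable (lineMass g) :=
  Measurable.lintegral_prod_right' (f := fun p : ℝ × ℝ => ENNReal.ofReal (g (p.2 ^ 2 + p.1)))
    (by fun_prop)

/-- Under `r = s²` the factor `r^{-1/2}` cancels `s` in `dr = 2s ds`, and the remaining `2` accounts
for the two half-lines. -/
theorem lintegral_rpow_eq_lineMass (g : ℝ → ℝ) (q : ℝ) :
    ∫⁻ r in Ioi (0 : ℝ), ENNReal.ofReal (r ^ (-(1 / 2) : ℝ) * g (r + q)) = lineMass g q := by
  have h := lintegral_comp_abs fun s => ENNReal.ofReal (g (s ^ 2 + q))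
  simp only [sq_abs] at h
  rw [lineMass, h, lintegral_Ioi_comp_sq, ← lintegral_const_mul' _ _ (by simp)]
  refine setLIntegral_congr_fun measurableSet_Ioi fun s hs => ?_
  have hs' : (0 : ℝ) < s := hs
  have e : (s ^ 2) ^ (-(1 / 2) : ℝ) = s⁻¹ := by
    rw [Real.rpow_neg (by positivity), ← Real.sqrt_eq_rpow, Real.sqrt_sq hs'.le]
  rw [e, ← ENNReal.ofReal_mul (by positivity), ← mul_assoc, mul_assoc 2, mul_inv_cancel₀ hs'.ne',
    mul_one, ENNReal.ofReal_mul zero_le_two, ENNReal.ofReal_ofNat]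

/-- No finiteness is needed: a divergent integral gives `0` on both sides. -/
theorem marginalGen_eq_toReal (hg : Measurable g) (hg0 : ∀ u, 0 ≤ u → 0 ≤ g u) {q : ℝ}
    (hq : 0 ≤ q) : marginalGen g q = (lineMass g q).toReal := by
  rw [marginalGen, integral_eq_lintegral_of_nonneg_ae, lintegral_rpow_eq_lineMass]
  · filter_upwards [ae_restrict_mem measurableSet_Ioi] with r hr
    have hr' : (0 : ℝ) < r := hr
    exact mul_nonneg (Real.rpow_nonneg hr'.le _) (hg0 _ (by positivity))
  · exact Measurable.aestronglyMeasurable (by fun_prop)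

/-- Division by `g^{(n)}(q)`, which is the line mass, already normalizes the conditional generator,
so its constant `c₁` is `1`. -/
theorem ecCdf_conditionalGen (hg : Measurable g) (hg0 : ∀ u, 0 ≤ u → 0 ≤ g u) {q : ℝ}
    (hq : 0 ≤ q) (h0 : lineMass g q ≠ 0) (htop : lineMass g q ≠ ∞) (t : ℝ) :
    ecCdf (conditionalGen g q) t =
      (∫⁻ s in Iic t, ENNReal.ofReal (g (s ^ 2 + q))).toReal / (lineMass g q).toReal := by
  have hpos : 0 < (lineMass g q).toReal := ENNReal.toReal_pos h0 htop
  have hgm : Measurable fun s : ℝ => g (s ^ 2 + q) := by fun_prop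
  have hnn : ∀ s : ℝ, 0 ≤ g (s ^ 2 + q) := fun s => hg0 _ (by positivity)
  have hc : normConst 1 (conditionalGen g q) = 1 := by
    have h := (volume_preserving_funUnique (Fin 1) ℝ).integral_comp
      (MeasurableEquiv.measurableEmbedding _) fun s => g (s ^ 2 + q) / (lineMass g q).toReal
    have e : ∀ x : Fin 1 → ℝ, conditionalGen g q (x ⬝ᵥ x) =
        g (MeasurableEquiv.funUnique (Fin 1) ℝ x ^ 2 + q) / (lineMass g q).toReal := by
      intro x
      rw [conditionalGen, marginalGen_eq_toReal hg hg0 hq, dotProduct, Fin.sum_univ_one, ← sq]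
      rfl
    have h' : ∫ x : Fin 1 → ℝ, conditionalGen g q (x ⬝ᵥ x) =
        ∫ s : ℝ, g (s ^ 2 + q) / (lineMass g q).toReal := by
      rw [integral_congr_ae (.of_forall e)]
      exact h
    rw [normConst, h', integral_div,
      integral_eq_lintegral_of_nonneg_ae (.of_forall hnn) hgm.aestronglyMeasurable]
    rw [← lineMass, div_self hpos.ne', inv_one]
  have hd : ∀ s : ℝ, ecDensity (0 : Fin 1 → ℝ) (1 : Matrix (Fin 1) (Fin 1) ℝ)
      (conditionalGen g q) ![s] = g (s ^ 2 + q) / (lineMass g q).toReal := by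
    intro s
    rw [ecDensity, hc, det_one, Real.one_rpow, one_mul, one_mul, conditionalGen,
      marginalGen_eq_toReal hg hg0 hq]
    simp [quadForm, sq]
  rw [ecCdf]
  simp only [hd]
  rw [integral_div, integral_eq_lintegral_of_nonneg_ae (.of_forall hnn) hgm.aestronglyMeasurable]

/-- Fubini for the spherical density, whose total mass is one. It yields both the constant of the
marginal generator and the almost everywhere finiteness of the line mass. -/
theorem IsDensityGenerator.lintegral_lineMass (hg : IsDensityGenerator (n + 1) g) :
    ∫⁻ y : Fin n → ℝ, lineMass g (y ⬝ᵥ y) = ENNReal.ofReal (normConst (n + 1) g)⁻¹ := by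
  have hgm := hg.measurable
  have hc := hg.normConst_pos (Nat.le_add_left 1 n)
  have hdm : Measurable fun y : Fin n → ℝ => y ⬝ᵥ y := by
    unfold dotProduct
    fun_prop
  have h := (hg.isProbabilityMeasure_sphericalLaw (Nat.le_add_left 1 n)).measure_univ
  have e : ∀ z : EuclideanSpace ℝ (Fin (n + 1)), ENNReal.ofReal (normConst (n + 1) g *
      g (‖z‖ ^ 2)) = ENNReal.ofReal (normConst (n + 1) g) *
        ENNReal.ofReal (g (z 0 ^ 2 + tailVec z ⬝ᵥ tailVec z)) := by
    intro z
    rw [ENNReal.ofReal_mul hc.le, ← dotProduct_self_ofLp, dotProduct, Fin.sum_univ_succ, ← sq]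
    rfl
  rw [sphericalLaw, withDensity_apply _ .univ, setLIntegral_univ, lintegral_congr e,
    lintegral_const_mul _ (by fun_prop), lintegral_prod_eq_euclideanSpace_succ
      (fun p => ENNReal.ofReal (g (p.1 ^ 2 + p.2 ⬝ᵥ p.2))), Measure.volume_eq_prod,
    lintegral_prod_symm _ (by fun_prop)] at h
  rw [ENNReal.ofReal_inv_of_pos hc]
  exact ENNReal.eq_inv_of_mul_eq_one_left ((mul_comm _ _).trans h)

theorem IsDensityGenerator.normConst_marginalGen (hg : IsDensityGenerator (n + 1) g) :
    normConst n (marginalGen g) = normConst (n + 1) g := by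
  have hdm : Measurable fun y : Fin n → ℝ => y ⬝ᵥ y := by
    unfold dotProduct
    fun_prop
  have hm : Measurable fun y : Fin n → ℝ => lineMass g (y ⬝ᵥ y) :=
    (measurable_lineMass hg.measurable).comp hdm
  have e : ∀ y : Fin n → ℝ, marginalGen g (y ⬝ᵥ y) = (lineMass g (y ⬝ᵥ y)).toReal := fun y =>
    marginalGen_eq_toReal hg.measurable hg.nonneg (by simpa using dotProduct_star_self_nonneg y)
  have h := hg.lintegral_lineMass
  rw [normConst, integral_congr_ae (.of_forall e), integral_toReal hm.aemeasurable
    (ae_lt_top hm (by rw [h]; exact ENNReal.ofReal_ne_top)), h, ENNReal.toReal_ofReal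
    (inv_nonneg.2 (hg.normConst_pos (Nat.le_add_left 1 n)).le), inv_inv]

theorem quadForm_nonneg {Om : Matrix (Fin n) (Fin n) ℝ} (hOm : Om.PosDef) (m x : Fin n → ℝ) :
    0 ≤ quadForm m Om x := by
  have h := hOm.inv.posSemidef.dotProduct_mulVec_nonneg (x - m)
  rwa [star_trivial] at h

theorem sqrt_mul_sqrt_self {A : Matrix (Fin n) (Fin n) ℝ} (hA : A.PosDef) :
    CFC.sqrt A * CFC.sqrt A = A := CFC.sqrt_mul_sqrt_self A hA.posSemidef.nonneg

theorem sqrt_transpose (A : Matrix (Fin n) (Fin n) ℝ) : (CFC.sqrt A)ᵀ = CFC.sqrt A :=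
  (CFC.sqrt_nonneg A).posSemidef.isHermitian

theorem det_sqrt_ne_zero {A : Matrix (Fin n) (Fin n) ℝ} (hA : A.PosDef) :
    (CFC.sqrt A).det ≠ 0 := by
  intro h
  have h1 := hA.det_pos
  rw [← sqrt_mul_sqrt_self hA, det_mul, h, mul_zero] at h1
  exact lt_irrefl _ h1

/-- The substitution `y = Ω^{-1/2}(x - m)` reduces the integral over `x` to a finite one. -/
theorem IsDensityGenerator.lineMass_quadForm_lt_top (hg : IsDensityGenerator (n + 1) g)
    {Om : Matrix (Fin n) (Fin n) ℝ} (hOm : Om.PosDef) (m : Fin n → ℝ) :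
    ∀ᵐ x : Fin n → ℝ, lineMass g (quadForm m Om x) < ∞ := by
  have hdm : Measurable fun y : Fin n → ℝ => y ⬝ᵥ y := by
    unfold dotProduct
    fun_prop
  have hm : Measurable fun y : Fin n → ℝ => lineMass g (y ⬝ᵥ y) :=
    (measurable_lineMass hg.measurable).comp hdm
  set S := CFC.sqrt Om⁻¹
  have hq : ∀ x, quadForm m Om x = (S *ᵥ x + -(S *ᵥ m)) ⬝ᵥ (S *ᵥ x + -(S *ᵥ m)) := by
    intro x
    rw [← sub_eq_add_neg, ← mulVec_sub, quadForm, ← sqrt_mul_sqrt_self hOm.inv, ← mulVec_mulVec,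
      dotProduct_mulVec, ← mulVec_transpose, sqrt_transpose]
  have h := lintegral_comp_mulVec_add (det_sqrt_ne_zero hOm.inv) (-(S *ᵥ m)) hm
  rw [hg.lintegral_lineMass] at h
  simp only [hq]
  refine ae_lt_top (f := fun x => lineMass g ((S *ᵥ x + -(S *ᵥ m)) ⬝ᵥ (S *ᵥ x + -(S *ᵥ m))))
    (hm.comp ?_) ?_
  · exact Measurable.add_const (Continuous.measurable (by fun_prop)) _
  · rw [h]
    exact ENNReal.mul_ne_top ENNReal.ofReal_ne_top ENNReal.ofReal_ne_top

/-- The skew-elliptical density as a partial integral of the spherical generator. -/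
theorem IsDensityGenerator.ofReal_skewDensity (hg : IsDensityGenerator (n + 1) g)
    {Om : Matrix (Fin n) (Fin n) ℝ} (hOm : Om.PosDef) (m α : Fin n → ℝ) :
    ∀ᵐ x : Fin n → ℝ, ENNReal.ofReal (skewDensity m Om α g x) =
      ENNReal.ofReal (2 * normConst (n + 1) g * (√Om.det)⁻¹) *
        ∫⁻ s in Iic (α ⬝ᵥ ((scaleMatrix Om)⁻¹ *ᵥ (x - m))),
          ENNReal.ofReal (g (s ^ 2 + quadForm m Om x)) := by
  filter_upwards [hg.lineMass_quadForm_lt_top hOm m] with x hx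
  have hq := quadForm_nonneg hOm m x
  have hc := hg.normConst_pos (Nat.le_add_left 1 n)
  have hd : Om.det ^ (-(1 / 2) : ℝ) = (√Om.det)⁻¹ := by
    rw [Real.rpow_neg hOm.det_pos.le, Real.sqrt_eq_rpow]
  set q := quadForm m Om x with hqdef
  set t := α ⬝ᵥ ((scaleMatrix Om)⁻¹ *ᵥ (x - m))
  have hle : ∫⁻ s in Iic t, ENNReal.ofReal (g (s ^ 2 + q)) ≤ lineMass g q :=
    setLIntegral_le_lintegral _ _
  rw [skewDensity, ecDensity, ← hqdef, hd, hg.normConst_marginalGen,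
    marginalGen_eq_toReal hg.measurable hg.nonneg hq]
  -- Where the line mass vanishes, `g_q` divides by zero, but the elliptical factor and the partial
  -- integral are both `0`.
  rcases eq_or_ne (lineMass g q) 0 with h0 | h0
  · rw [h0, nonpos_iff_eq_zero] at hle
    simp [h0, hle]
  · rw [ecCdf_conditionalGen hg.measurable hg.nonneg hq h0 hx.ne]
    have hpos := (ENNReal.toReal_pos h0 hx.ne).ne'
    rw [← ENNReal.ofReal_toReal (hle.trans_lt hx).ne, ← ENNReal.ofReal_mul (by positivity)]
    congr 1
    rw [ENNReal.ofReal_toReal (hle.trans_lt hx).ne]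
    field_simp

end SkewElliptical

end

/-! ### Determinant and inverse of a rank-one update. -/

section RankOneUpdate

variable {ι : Type*} [Fintype ι] [DecidableEq ι]

theorem Matrix.mul_transpose_add_vecMulVec (A : Matrix ι ι ℝ) (b : ι → ℝ) :
    A * Aᵀ + vecMulVec (A *ᵥ b) (A *ᵥ b) = A * (1 + vecMulVec b b) * Aᵀ := by
  rw [mul_add, add_mul, mul_one, mul_vecMulVec, vecMulVec_mul, vecMul_transpose]

theorem Matrix.det_mul_transpose_add_vecMulVec (A : Matrix ι ι ℝ) (b : ι → ℝ) :
    (A * Aᵀ + vecMulVec (A *ᵥ b) (A *ᵥ b)).det = A.det ^ 2 * (1 + b ⬝ᵥ b) := by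
  rw [mul_transpose_add_vecMulVec, det_mul, det_mul, det_transpose, vecMulVec_eq Unit,
    det_one_add_replicateCol_mul_replicateRow]
  ring

/-- The Sherman–Morrison formula for the quadratic form of the inverse. -/
theorem Matrix.dotProduct_inv_mulVec_of_rankOne {A : Matrix ι ι ℝ} (hA : IsUnit A.det)
    (b v : ι → ℝ) :
    (A *ᵥ v) ⬝ᵥ ((A * Aᵀ + vecMulVec (A *ᵥ b) (A *ᵥ b))⁻¹ *ᵥ (A *ᵥ v)) =
      v ⬝ᵥ v - (b ⬝ᵥ v) ^ 2 / (1 + b ⬝ᵥ b) := by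
  have hb : 0 < 1 + b ⬝ᵥ b := by
    have : 0 ≤ b ⬝ᵥ b := by simpa using dotProduct_star_self_nonneg b
    linarith
  have hAt : IsUnit (Aᵀ).det := by rwa [det_transpose]
  have hM : IsUnit (A * Aᵀ + vecMulVec (A *ᵥ b) (A *ᵥ b)).det := by
    rw [det_mul_transpose_add_vecMulVec]
    exact (hA.pow 2).mul (isUnit_iff_ne_zero.2 hb.ne')
  -- `w` is `(1 + bb')⁻¹ v`, found by correcting `v` along `b`.
  set w := v - ((b ⬝ᵥ v) / (1 + b ⬝ᵥ b)) • b with hw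
  have h1 : (1 + vecMulVec b b) *ᵥ w = v := by
    rw [add_mulVec, one_mulVec, vecMulVec_mulVec]
    have e : b ⬝ᵥ w = (b ⬝ᵥ v) / (1 + b ⬝ᵥ b) := by
      rw [hw, dotProduct_sub, dotProduct_smul, smul_eq_mul]
      field_simp
      ring
    rw [e, hw]
    ext i
    simp only [Pi.smul_apply, Pi.add_apply, Pi.sub_apply, smul_eq_mul,
      MulOpposite.smul_eq_mul_unop, MulOpposite.unop_op]
    ring
  have h2 : (A * Aᵀ + vecMulVec (A *ᵥ b) (A *ᵥ b))⁻¹ *ᵥ (A *ᵥ v) = (Aᵀ)⁻¹ *ᵥ w := by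
    have h3 : (A * Aᵀ + vecMulVec (A *ᵥ b) (A *ᵥ b)) *ᵥ ((Aᵀ)⁻¹ *ᵥ w) = A *ᵥ v := by
      rw [mul_transpose_add_vecMulVec, mulVec_mulVec, mul_assoc, mul_nonsing_inv _ hAt, mul_one,
        ← mulVec_mulVec, h1]
    rw [← h3, mulVec_mulVec, nonsing_inv_mul _ hM, one_mulVec]
  rw [h2, dotProduct_mulVec, ← mulVec_transpose, transpose_nonsing_inv, transpose_transpose,
    mulVec_mulVec, nonsing_inv_mul _ hA, one_mulVec, hw, dotProduct_sub, dotProduct_smul,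
    dotProduct_comm v b, smul_eq_mul]
  ring

end RankOneUpdate

/-! ### The skew-elliptical law as an affine image of a folded spherical law. -/

noncomputable section

namespace SkewElliptical

open scoped ENNReal

section Law

variable {n : ℕ} {g : ℝ → ℝ} {Om Psi : Matrix (Fin n) (Fin n) ℝ} {α δ : Fin n → ℝ}

/-- Additive representation: half of a spherical vector is mapped affinely. -/
theorem lintegral_sphericalLaw_abs (hg : IsDensityGenerator (n + 1) g)
    {A : Matrix (Fin n) (Fin n) ℝ} (hA : IsUnit A.det) (b m : Fin n → ℝ)
    {f : (Fin n → ℝ) → ℝ≥0∞} (hf : Measurable f) :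
    ∫⁻ z, f (|z 0| • (A *ᵥ b) + A *ᵥ tailVec z + m) ∂sphericalLaw (n + 1) g =
      ∫⁻ x, ENNReal.ofReal (2 * normConst (n + 1) g * |A.det|⁻¹) *
        (∫⁻ t in Ioi (0 : ℝ), ENNReal.ofReal (g (t ^ 2 +
          (A⁻¹ *ᵥ (x - m) - t • b) ⬝ᵥ (A⁻¹ *ᵥ (x - m) - t • b)))) * f x := by
  have hgm := hg.measurable
  have hc := hg.normConst_pos (Nat.le_add_left 1 n)
  have hmul : ∀ M : Matrix (Fin n) (Fin n) ℝ, Measurable fun x : Fin n → ℝ => M *ᵥ x := fun M =>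
    Continuous.measurable (by fun_prop)
  have hmA := hmul A
  have hmA' := hmul A⁻¹
  have hd : Measurable fun p : (Fin n → ℝ) × (Fin n → ℝ) => p.1 ⬝ᵥ p.2 :=
    Continuous.measurable (by fun_prop)
  have hd' : ∀ {β : Type} [MeasurableSpace β] {u : β → Fin n → ℝ}, Measurable u →
    Measurable fun x => u x ⬝ᵥ u x := fun hu => hd.comp (hu.prodMk hu)
  set C := normConst (n + 1) g
  set Φ : ℝ → (Fin n → ℝ) → ℝ≥0∞ := fun t y =>
    ENNReal.ofReal (C * g (t ^ 2 + y ⬝ᵥ y)) * f (t • (A *ᵥ b) + A *ᵥ y + m) with hΦ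
  have hquad : Measurable fun p : ℝ × (Fin n → ℝ) => p.2 ⬝ᵥ p.2 := hd' measurable_snd
  have hAsnd : Measurable fun p : ℝ × (Fin n → ℝ) => A *ᵥ p.2 := hmA.comp measurable_snd
  have hquad' : Measurable fun p : ℝ × (Fin n → ℝ) =>
      (A⁻¹ *ᵥ (p.2 - m) - p.1 • b) ⬝ᵥ (A⁻¹ *ᵥ (p.2 - m) - p.1 • b) := by
    have : Measurable fun p : ℝ × (Fin n → ℝ) => A⁻¹ *ᵥ (p.2 - m) :=
      hmA'.comp (by fun_prop)
    exact hd' (by fun_prop)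
  have hT : Measurable fun z : EuclideanSpace ℝ (Fin (n + 1)) => A *ᵥ tailVec z :=
    hmA.comp measurable_tailVec
  have step1 : ∫⁻ z, f (|z 0| • (A *ᵥ b) + A *ᵥ tailVec z + m) ∂sphericalLaw (n + 1) g =
      ∫⁻ t : ℝ, ∫⁻ y, Φ |t| y := by
    rw [sphericalLaw, lintegral_withDensity_eq_lintegral_mul _ (by fun_prop) (by fun_prop)]
    have e : ∀ z : EuclideanSpace ℝ (Fin (n + 1)),
        ((fun z : EuclideanSpace ℝ (Fin (n + 1)) => ENNReal.ofReal (C * g (‖z‖ ^ 2))) *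
          fun z : EuclideanSpace ℝ (Fin (n + 1)) =>
            f (|z 0| • (A *ᵥ b) + A *ᵥ tailVec z + m)) z = Φ |z 0| (tailVec z) := by
      intro z
      rw [hΦ, Pi.mul_apply, ← dotProduct_self_ofLp, dotProduct, Fin.sum_univ_succ, ← sq]
      simp only [sq_abs]
      rfl
    rw [lintegral_congr e, lintegral_prod_eq_euclideanSpace_succ (fun p => Φ |p.1| p.2),
      Measure.volume_eq_prod, lintegral_prod _ (by fun_prop)]
  have step2 : ∀ t : ℝ, ∫⁻ y, Φ t y = ENNReal.ofReal |A.det|⁻¹ *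
      ∫⁻ x, ENNReal.ofReal (C * g (t ^ 2 +
        (A⁻¹ *ᵥ (x - m) - t • b) ⬝ᵥ (A⁻¹ *ᵥ (x - m) - t • b))) * f x := by
    intro t
    rw [← lintegral_comp_mulVec_add hA.ne_zero (t • (A *ᵥ b) + m)]
    · refine lintegral_congr fun y => ?_
      have e1 : A *ᵥ y + (t • (A *ᵥ b) + m) = t • (A *ᵥ b) + A *ᵥ y + m := by abel
      have e2 : A⁻¹ *ᵥ (t • (A *ᵥ b) + A *ᵥ y + m - m) - t • b = y := by
        rw [add_sub_cancel_right, mulVec_add, mulVec_smul, mulVec_mulVec, mulVec_mulVec,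
          nonsing_inv_mul _ hA, one_mulVec, one_mulVec, add_sub_cancel_left]
      simp only [hΦ]
      rw [e1, e2]
    · have := hquad'.comp (measurable_prodMk_left (x := t))
      simp only [Function.comp_def] at this
      fun_prop
  rw [step1, lintegral_comp_abs fun t => ∫⁻ y, Φ t y]
  simp only [step2]
  rw [lintegral_const_mul' _ _ ENNReal.ofReal_ne_top, lintegral_lintegral_swap (by fun_prop),
    ← lintegral_const_mul' _ _ ENNReal.ofReal_ne_top, ← lintegral_const_mul' _ _ (by simp)]
  refine lintegral_congr fun x => ?_
  have hx := hquad'.comp (measurable_prodMk_right (y := x))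
  simp only [Function.comp_def] at hx
  rw [lintegral_mul_const _ (by fun_prop)]
  simp only [ENNReal.ofReal_mul hc.le]
  rw [lintegral_const_mul' _ _ ENNReal.ofReal_ne_top, ENNReal.ofReal_mul (by positivity),
    ENNReal.ofReal_mul zero_le_two, ENNReal.ofReal_ofNat]
  ring

theorem IsSkewParam.isUnit_det_mul_sqrt (hOm : Om.PosDef) (h : IsSkewParam Om α δ Psi) :
    IsUnit (scaleMatrix Om * deltaMatrix δ * CFC.sqrt Psi).det := by
  rw [det_mul, det_mul]
  exact ((isUnit_det_scaleMatrix hOm).mul (isUnit_det_deltaMatrix h.delta_mem)).mul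
    (isUnit_iff_ne_zero.2 (det_sqrt_ne_zero h.posDef))

/-- Writing `ωδ` as `A b` puts `Ω = AA' + (Ab)(Ab)'` in the form of the rank-one lemmas. -/
theorem IsSkewParam.mul_sqrt_mulVec (h : IsSkewParam Om α δ Psi) :
    (scaleMatrix Om * deltaMatrix δ * CFC.sqrt Psi) *ᵥ ((CFC.sqrt Psi)⁻¹ *ᵥ lam δ) =
      scaleMatrix Om *ᵥ δ := by
  rw [mulVec_mulVec, mul_assoc, mul_nonsing_inv _ (isUnit_iff_ne_zero.2
    (det_sqrt_ne_zero h.posDef)), mul_one, ← mulVec_mulVec, deltaMatrix_mulVec_lam h.delta_mem]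

theorem IsSkewParam.scale_eq (hOm : Om.PosDef) (h : IsSkewParam Om α δ Psi) :
    Om = (scaleMatrix Om * deltaMatrix δ * CFC.sqrt Psi) *
      (scaleMatrix Om * deltaMatrix δ * CFC.sqrt Psi)ᵀ +
        vecMulVec (scaleMatrix Om *ᵥ δ) (scaleMatrix Om *ᵥ δ) := by
  conv_lhs => rw [← scaleMatrix_mul_corrMatrix_mul hOm, h.corr_eq,
    deltaMatrix_mul_add_mul h.delta_mem, ← sqrt_mul_sqrt_self h.posDef]
  rw [transpose_mul, transpose_mul, sqrt_transpose, deltaMatrix_transpose, scaleMatrix_transpose,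
    mul_add, add_mul, mul_vecMulVec, vecMulVec_mul, ← mulVec_transpose, scaleMatrix_transpose]
  simp only [mul_assoc]

theorem IsSkewParam.dotProduct_self (h : IsSkewParam Om α δ Psi) :
    ((CFC.sqrt Psi)⁻¹ *ᵥ lam δ) ⬝ᵥ ((CFC.sqrt Psi)⁻¹ *ᵥ lam δ) = lam δ ⬝ᵥ (Psi⁻¹ *ᵥ lam δ) := by
  conv_rhs => rw [← sqrt_mul_sqrt_self h.posDef, Matrix.mul_inv_rev, ← mulVec_mulVec, dotProduct_mulVec,
    ← mulVec_transpose, transpose_nonsing_inv, sqrt_transpose]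

/-- The normalization of `α` makes the argument of the skewing function equal to `b'v/√(1 + b'b)`,
the limit of integration produced by completing the square. -/
theorem IsSkewParam.dotProduct_inv_scaleMatrix (h : IsSkewParam Om α δ Psi)
    (u : Fin n → ℝ) : α ⬝ᵥ ((scaleMatrix Om)⁻¹ *ᵥ u) =
      (((CFC.sqrt Psi)⁻¹ *ᵥ lam δ) ⬝ᵥ
        ((scaleMatrix Om * deltaMatrix δ * CFC.sqrt Psi)⁻¹ *ᵥ u)) /
      √(1 + ((CFC.sqrt Psi)⁻¹ *ᵥ lam δ) ⬝ᵥ ((CFC.sqrt Psi)⁻¹ *ᵥ lam δ)) := by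
  have hP : Psi⁻¹ *ᵥ lam δ = (CFC.sqrt Psi)⁻¹ *ᵥ ((CFC.sqrt Psi)⁻¹ *ᵥ lam δ) := by
    rw [mulVec_mulVec, ← Matrix.mul_inv_rev, sqrt_mul_sqrt_self h.posDef]
  rw [h.dotProduct_self, div_eq_inv_mul]
  nth_rw 1 [h.alpha_eq_inv_sqrt_smul]
  rw [smul_dotProduct, smul_eq_mul, Matrix.mul_inv_rev, Matrix.mul_inv_rev, ← mulVec_mulVec u,
    ← mulVec_mulVec, dotProduct_mulVec _ (CFC.sqrt Psi)⁻¹, ← mulVec_transpose,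
    transpose_nonsing_inv, sqrt_transpose, dotProduct_mulVec _ (deltaMatrix δ)⁻¹,
    ← mulVec_transpose, transpose_nonsing_inv, deltaMatrix_transpose, hP]

/-- The skew-elliptical law is the law of an affine map of a spherical vector, the first
coordinate of which is replaced by its absolute value. -/
theorem IsSkewParam.map_sphericalLaw (hg : IsDensityGenerator (n + 1) g) (hOm : Om.PosDef)
    (h : IsSkewParam Om α δ Psi) (m : Fin n → ℝ) :
    (sphericalLaw (n + 1) g).map (fun z => |z 0| • (scaleMatrix Om *ᵥ δ) +
      (scaleMatrix Om * deltaMatrix δ * CFC.sqrt Psi) *ᵥ tailVec z + m) =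
        skewLaw m Om α g := by
  have hgm := hg.measurable
  have hA := h.isUnit_det_mul_sqrt hOm
  have hα := h.dotProduct_inv_scaleMatrix
  have hO := h.scale_eq hOm
  rw [← h.mul_sqrt_mulVec] at hO ⊢
  set A := scaleMatrix Om * deltaMatrix δ * CFC.sqrt Psi
  set b := (CFC.sqrt Psi)⁻¹ *ᵥ lam δ
  have hb : 0 < 1 + b ⬝ᵥ b := by
    have : 0 ≤ b ⬝ᵥ b := by simpa using dotProduct_star_self_nonneg b
    linarith
  have hdet : √Om.det = |A.det| * √(1 + b ⬝ᵥ b) := by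
    rw [hO, det_mul_transpose_add_vecMulVec, Real.sqrt_mul (sq_nonneg _), Real.sqrt_sq_eq_abs]
  have hdA : 0 < |A.det| := abs_pos.2 hA.ne_zero
  have hmA : Measurable fun x : Fin n → ℝ => A *ᵥ x := Continuous.measurable (by fun_prop)
  have hT : Measurable fun z : EuclideanSpace ℝ (Fin (n + 1)) => A *ᵥ tailVec z :=
    hmA.comp measurable_tailVec
  set D : (Fin n → ℝ) → ℝ≥0∞ := fun x =>
    ENNReal.ofReal (2 * normConst (n + 1) g * |A.det|⁻¹) *
      ∫⁻ t in Ioi (0 : ℝ), ENNReal.ofReal (g (t ^ 2 +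
        (A⁻¹ *ᵥ (x - m) - t • b) ⬝ᵥ (A⁻¹ *ᵥ (x - m) - t • b))) with hD
  have hDm : Measurable D := by
    refine Measurable.const_mul (Measurable.lintegral_prod_right'
      (f := fun p : (Fin n → ℝ) × ℝ => ENNReal.ofReal (g (p.2 ^ 2 +
        (A⁻¹ *ᵥ (p.1 - m) - p.2 • b) ⬝ᵥ (A⁻¹ *ᵥ (p.1 - m) - p.2 • b)))) ?_) _
    have : Measurable fun p : (Fin n → ℝ) × ℝ =>
        (A⁻¹ *ᵥ (p.1 - m) - p.2 • b) ⬝ᵥ (A⁻¹ *ᵥ (p.1 - m) - p.2 • b) :=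
      Continuous.measurable (by fun_prop)
    fun_prop
  have hlaw : skewLaw m Om α g = volume.withDensity D := by
    refine withDensity_congr_ae ?_
    filter_upwards [hg.ofReal_skewDensity hOm m α] with x hx
    have hv : x - m = A *ᵥ (A⁻¹ *ᵥ (x - m)) := by
      rw [mulVec_mulVec, mul_nonsing_inv _ hA, one_mulVec]
    have hq : quadForm m Om x = (A⁻¹ *ᵥ (x - m)) ⬝ᵥ (A⁻¹ *ᵥ (x - m)) -
        (b ⬝ᵥ (A⁻¹ *ᵥ (x - m))) ^ 2 / (1 + b ⬝ᵥ b) := by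
      rw [← dotProduct_inv_mulVec_of_rankOne hA, ← hO, ← hv, quadForm]
    -- With `s = b'v/k - kt`, one has `s² + v'v - (b'v)²/k² = t² + |v - t b|²`. The factor `k` from
    -- `ds` cancels the one in `√det Ω = |det A| k`.
    rw [hx, hα, hq, hD, hdet, ← restrict_Iio_eq_restrict_Iic,
      lintegral_Ioi_comp_sub_mul _ _ (Real.sqrt_pos.2 hb), ← mul_assoc,
      ← ENNReal.ofReal_mul (by have := hg.normConst_pos (Nat.le_add_left 1 n); positivity)]
    have hk := Real.sqrt_pos.2 hb
    have hk2 : √(1 + b ⬝ᵥ b) ^ 2 = 1 + b ⬝ᵥ b := Real.sq_sqrt hb.le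
    set k := √(1 + b ⬝ᵥ b)
    set v := A⁻¹ *ᵥ (x - m)
    congr 2
    · field_simp
    · ext t
      congr 2
      have : (v - t • b) ⬝ᵥ (v - t • b) = v ⬝ᵥ v - 2 * t * (b ⬝ᵥ v) + t ^ 2 * (k ^ 2 - 1) := by
        rw [hk2]
        simp only [sub_dotProduct, dotProduct_sub, dotProduct_smul, smul_dotProduct, smul_eq_mul,
          dotProduct_comm v b]
        ring
      rw [this, ← hk2]
      field_simp
      ring
  rw [hlaw]
  refine Measure.ext_of_lintegral _ fun f hf => ?_
  rw [lintegral_map hf (by fun_prop), lintegral_sphericalLaw_abs hg hA b m hf,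
    lintegral_withDensity_eq_lintegral_mul _ hDm hf]
  rfl

end Law

end SkewElliptical

end

/-! ### Joint laws and independence. -/

namespace ProbabilityTheory

variable {Ω Ω' β γ : Type*} [MeasurableSpace Ω] [MeasurableSpace Ω'] [MeasurableSpace β]
  [MeasurableSpace γ] {P : Measure Ω} {X : Ω → β} {Y : Ω → γ} {μ : Measure β} {ν : Measure γ}

theorem IndepFun.hasLaw_prodMk [IsFiniteMeasure P] (h : IndepFun X Y P) (hX : HasLaw X μ P)
    (hY : HasLaw Y ν P) : HasLaw (fun w => (X w, Y w)) (μ.prod ν) P where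
  aemeasurable := hX.aemeasurable.prodMk hY.aemeasurable
  map_eq := by
    rw [(indepFun_iff_map_prod_eq_prod_map_map hX.aemeasurable hY.aemeasurable).1 h, hX.map_eq,
      hY.map_eq]

theorem HasLaw.measurable_comp (hX : HasLaw X μ P) {f : β → γ} (hf : Measurable f) :
    HasLaw (fun w => f (X w)) (μ.map f) P :=
  (hf.measurePreserving μ).hasLaw.comp hX

theorem HasLaw.indepFun_of_prod [IsProbabilityMeasure P] [IsProbabilityMeasure μ]
    [IsProbabilityMeasure ν] (h : HasLaw (fun w => (X w, Y w)) (μ.prod ν) P) :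
    IndepFun X Y P := by
  have hX : HasLaw X μ P := measurePreserving_fst.hasLaw.comp h
  have hY : HasLaw Y ν P := measurePreserving_snd.hasLaw.comp h
  rw [indepFun_iff_map_prod_eq_prod_map_map hX.aemeasurable hY.aemeasurable, h.map_eq, hX.map_eq,
    hY.map_eq]

theorem HasLaw.identDistrib_of_eq {Q : Measure Ω'} {Z : Ω' → β} (hX : HasLaw X μ P)
    (hZ : HasLaw Z μ Q) : IdentDistrib X Z P Q :=
  ⟨hX.aemeasurable, hZ.aemeasurable, hX.map_eq.trans hZ.map_eq.symm⟩

theorem IndepFun.comp_measurePreserving {δ : Type*} [MeasurableSpace δ] {f : β → γ} {g : β → δ}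
    (h : IndepFun f g μ) (hf : Measurable f) (hg : Measurable g) {T : Ω → β}
    (hT : MeasurePreserving T P μ) : IndepFun (fun w => f (T w)) (fun w => g (T w)) P := by
  rw [indepFun_iff_measure_inter_preimage_eq_mul] at h ⊢
  intro s t hs ht
  have h1 := hT.measure_preimage ((hf hs).inter (hg ht)).nullMeasurableSet
  have h2 := hT.measure_preimage (hf hs).nullMeasurableSet
  have h3 := hT.measure_preimage (hg ht).nullMeasurableSet
  have h4 := h s t hs ht
  rw [← h1, ← h2, ← h3] at h4
  exact h4

/-- If `X` is independent of `(Y, Z)` and `Y` of `Z`, then `(X, Y)` is independent of `Z`. -/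
theorem IndepFun.prodMk_left_of_prodMk_right {δ : Type*} [MeasurableSpace δ] {Z : Ω → δ}
    [IsProbabilityMeasure P] (hX : AEMeasurable X P) (hY : AEMeasurable Y P)
    (hZ : AEMeasurable Z P) (h : IndepFun X (fun w => (Y w, Z w)) P) (h' : IndepFun Y Z P) :
    IndepFun (fun w => (X w, Y w)) Z P := by
  have := Measure.isProbabilityMeasure_map hX
  have := Measure.isProbabilityMeasure_map hY
  have := Measure.isProbabilityMeasure_map hZ
  have h1 := h.hasLaw_prodMk (μ := P.map X) ⟨hX, rfl⟩
    (h'.hasLaw_prodMk (μ := P.map Y) (ν := P.map Z) ⟨hY, rfl⟩ ⟨hZ, rfl⟩)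
  have h2 := (measurePreserving_prodAssoc (P.map X) (P.map Y) (P.map Z)).symm.hasLaw.comp h1
  exact HasLaw.indepFun_of_prod h2

end ProbabilityTheory

/-! ### The stochastic representations. -/

noncomputable section

namespace SkewElliptical

open scoped ENNReal

variable {n : ℕ} {g : ℝ → ℝ} {Om Psi : Matrix (Fin n) (Fin n) ℝ} {α δ : Fin n → ℝ}
  {Ω Ω' : Type*} [MeasurableSpace Ω] [MeasurableSpace Ω'] {P : Measure Ω} {P' : Measure Ω'}

/-- The law of `(U₁, U₂)` for a uniform vector on the sphere of `ℝⁿ⁺¹`. -/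
def splitSphere (n : ℕ) : Measure (ℝ × (Fin n → ℝ)) :=
  (uniformSphere (n + 1)).map fun u => (u 0, tailVec u)

/-- The map `(r, u, y) ↦ r (|u| c + A y) + m`. -/
def absAffine (A : Matrix (Fin n) (Fin n) ℝ) (c m : Fin n → ℝ) (p : ℝ × ℝ × (Fin n → ℝ)) :
    Fin n → ℝ :=
  p.1 • (|p.2.1| • c + A *ᵥ p.2.2) + m

theorem measurable_absAffine (A : Matrix (Fin n) (Fin n) ℝ) (c m : Fin n → ℝ) :
    Measurable (absAffine A c m) := by
  unfold absAffine
  exact Continuous.measurable (by fun_prop)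

theorem ae_pos_radialLaw (n : ℕ) (g : ℝ → ℝ) : ∀ᵐ r ∂radialLaw n g, 0 < r :=
  (withDensity_absolutelyContinuous _ _).ae_le (ae_restrict_mem measurableSet_Ioi)

theorem ae_mem_Ioo_betaMeasure (a b : ℝ) : ∀ᵐ t ∂betaMeasure a b, t ∈ Ioo (0 : ℝ) 1 := by
  have hm : Measurable (betaPDF a b) := (measurable_betaPDFReal _ _).ennreal_ofReal
  rw [betaMeasure, ae_withDensity_iff hm]
  refine .of_forall fun t ht => ?_
  by_contra h
  rw [betaPDF_eq, if_neg (show ¬(0 < t ∧ t < 1) from h), ENNReal.ofReal_zero] at ht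
  exact ht rfl

/-- Since `R₀ > 0` almost surely, `|R₀U₁| = R₀|U₁|`. Hence (a) and (b) only require the joint law of
`R₀` and the split unit vector. -/
theorem IsSkewParam.map_radialLaw_prod_splitSphere (hg : IsDensityGenerator (n + 1) g)
    (hOm : Om.PosDef) (h : IsSkewParam Om α δ Psi) (m : Fin n → ℝ) :
    ((radialLaw n g).prod (splitSphere n)).map
      (absAffine (scaleMatrix Om * deltaMatrix δ * CFC.sqrt Psi) (scaleMatrix Om *ᵥ δ) m) =
        skewLaw m Om α g := by
  have := isProbabilityMeasure_uniformSphere (Nat.le_add_left 1 n)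
  rw [← h.map_sphericalLaw hg hOm m, ← hg.map_smul_radialLaw_prod]
  set A := scaleMatrix Om * deltaMatrix δ * CFC.sqrt Psi
  set c := scaleMatrix Om *ᵥ δ
  have hm1 : Measurable fun u : EuclideanSpace ℝ (Fin (n + 1)) => (u 0, tailVec u) := by fun_prop
  have hT : Measurable fun z : EuclideanSpace ℝ (Fin (n + 1)) => A *ᵥ tailVec z :=
    (Continuous.measurable (f := fun x : Fin n → ℝ => A *ᵥ x) (by fun_prop)).comp
      measurable_tailVec
  have e : (radialLaw n g).prod (splitSphere n) =
      ((radialLaw n g).prod (uniformSphere (n + 1))).map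
        (Prod.map id fun u => (u 0, tailVec u)) := by
    rw [splitSphere, ← Measure.map_prod_map _ _ measurable_id hm1, Measure.map_id]
  rw [e, Measure.map_map (measurable_absAffine A c m) (measurable_id.prodMap hm1),
    Measure.map_map (by fun_prop) (by fun_prop)]
  refine Measure.map_congr ?_
  have hpos : ∀ᵐ p ∂(radialLaw n g).prod (uniformSphere (n + 1)), 0 < p.1 :=
    Measure.quasiMeasurePreserving_fst.ae (ae_pos_radialLaw n g)
  filter_upwards [hpos] with p hp
  have ht : tailVec (p.1 • p.2) = p.1 • tailVec p.2 := rfl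
  simp only [Function.comp_apply, absAffine, Prod.map, id, PiLp.smul_apply, smul_eq_mul, abs_mul,
    abs_of_pos hp, ht, mulVec_smul, smul_add, smul_smul]

theorem IsDataA.hasLaw_sphere {R₀ : Ω → ℝ} {U : Ω → EuclideanSpace ℝ (Fin (n + 1))}
    (h : IsDataA g P R₀ U) : HasLaw (fun w => (U w 0, tailVec (U w))) (splitSphere n) P :=
  h.law_U.measurable_comp (f := fun u => (u 0, tailVec u)) (by fun_prop)

theorem IsDataA.hasLaw_split [IsFiniteMeasure P] {R₀ : Ω → ℝ}
    {U : Ω → EuclideanSpace ℝ (Fin (n + 1))} (h : IsDataA g P R₀ U) :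
    HasLaw (fun w => (R₀ w, (U w 0, tailVec (U w)))) ((radialLaw n g).prod (splitSphere n)) P :=
  (h.indep.comp measurable_id (by fun_prop : Measurable fun u : EuclideanSpace ℝ (Fin (n + 1)) =>
    (u 0, tailVec u))).hasLaw_prodMk h.law_R₀ h.hasLaw_sphere

section DataB

variable {R₀ d₁ d₂ : Ω → ℝ} {V : Ω → EuclideanSpace ℝ (Fin 1)}
  {W : Ω → EuclideanSpace ℝ (Fin n)}

/-- Only `d₁²` has a prescribed law; non-negativity lets it determine `d₁` and `d₂` almost surely,
which also yields their measurability. -/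
theorem IsDataB.d₁_eq (h : IsDataB g P R₀ d₁ d₂ V W) : d₁ =ᵐ[P] fun w => √(d₁ w ^ 2) := by
  filter_upwards [h.nonneg_d₁] with w hw
  rw [Real.sqrt_sq hw]

theorem IsDataB.d₂_eq (h : IsDataB g P R₀ d₁ d₂ V W) : d₂ =ᵐ[P] fun w => √(1 - d₁ w ^ 2) := by
  filter_upwards [h.nonneg_d₂, h.sq_d₂] with w hw hw'
  rw [← hw', Real.sqrt_sq hw]

theorem IsDataB.aemeasurable_d₁ (h : IsDataB g P R₀ d₁ d₂ V W) : AEMeasurable d₁ P :=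
  h.law_d₁.aemeasurable.sqrt.congr h.d₁_eq.symm

theorem IsDataB.aemeasurable_d₂ (h : IsDataB g P R₀ d₁ d₂ V W) : AEMeasurable d₂ P :=
  ((h.law_d₁.aemeasurable.const_sub 1).sqrt).congr h.d₂_eq.symm

theorem IsDataB.hasLaw_sphere (hn : 1 ≤ n) [IsProbabilityMeasure P]
    (h : IsDataB g P R₀ d₁ d₂ V W) :
    HasLaw (fun w => (d₁ w * V w 0, d₂ w • (W w).ofLp)) (splitSphere n) P := by
  have h1 : HasLaw (fun w => (d₁ w ^ 2, (V w, W w))) ((betaMeasure (1 / 2) ((n : ℝ) / 2)).prod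
      ((uniformSphere 1).prod (uniformSphere n))) P :=
    (h.indep.2.1.comp (φ := fun p : ℝ × ℝ => p.1 ^ 2) (by fun_prop) measurable_id).hasLaw_prodMk
      h.law_d₁ (h.indep.2.2.hasLaw_prodMk h.law_V h.law_W)
  rw [splitSphere, map_uniformSphere_succ hn]
  refine (h1.measurable_comp (f := fun p => (√p.1 * p.2.1 0, √(1 - p.1) • p.2.2.ofLp))
    (by fun_prop)).congr ?_
  filter_upwards [h.d₁_eq, h.d₂_eq] with w hw hw'
  rw [← hw, ← hw']

theorem IsDataB.hasLaw_split (hn : 1 ≤ n) [IsProbabilityMeasure P]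
    (h : IsDataB g P R₀ d₁ d₂ V W) :
    HasLaw (fun w => (R₀ w, (d₁ w * V w 0, d₂ w • (W w).ofLp)))
      ((radialLaw n g).prod (splitSphere n)) P :=
  (h.indep.1.comp measurable_id (by fun_prop : Measurable fun p : (ℝ × ℝ) ×
    EuclideanSpace ℝ (Fin 1) × EuclideanSpace ℝ (Fin n) =>
      (p.1.1 * p.2.1 0, p.1.2 • p.2.2.ofLp))).hasLaw_prodMk h.law_R₀ (h.hasLaw_sphere hn)

theorem IsDataB.hasLaw_skewLaw (hn : 1 ≤ n) [IsProbabilityMeasure P]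
    (h : IsDataB g P R₀ d₁ d₂ V W) (hg : IsDensityGenerator (n + 1) g) (hOm : Om.PosDef)
    (hp : IsSkewParam Om α δ Psi) (m : Fin n → ℝ) :
    HasLaw (fun w => R₀ w • ((d₁ w * |V w 0|) • (scaleMatrix Om *ᵥ δ) +
      d₂ w • ((scaleMatrix Om * deltaMatrix δ * CFC.sqrt Psi) *ᵥ (W w).ofLp)) + m)
      (skewLaw m Om α g) P := by
  rw [← hp.map_radialLaw_prod_splitSphere hg hOm m]
  refine ((h.hasLaw_split hn).measurable_comp (measurable_absAffine _ _ m)).congr ?_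
  filter_upwards [h.nonneg_d₁] with w hw
  simp only [absAffine, abs_mul, abs_of_nonneg hw, mulVec_smul]

theorem IsDataB.isDataC [IsProbabilityMeasure P] (h : IsDataB g P R₀ d₁ d₂ V W) :
    IsDataC P R₀ d₁ P (fun w => d₁ w * R₀ w) (fun w => √(1 - d₁ w ^ 2) * R₀ w) V W where
  law_R := IdentDistrib.refl ((h.aemeasurable_d₁.mul h.law_R₀.aemeasurable).prodMk
    ((h.law_d₁.aemeasurable.const_sub 1).sqrt.mul h.law_R₀.aemeasurable))
  law_V := h.law_V
  law_W := h.law_W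
  indep := by
    refine ⟨?_, h.indep.2.2⟩
    have h1 := IndepFun.prodMk_left_of_prodMk_right h.law_R₀.aemeasurable
      (h.aemeasurable_d₁.prodMk h.aemeasurable_d₂)
      (h.law_V.aemeasurable.prodMk h.law_W.aemeasurable) h.indep.1 h.indep.2.1
    exact h1.comp (φ := fun p : ℝ × ℝ × ℝ => (p.2.1 * p.1, √(1 - p.2.1 ^ 2) * p.1))
      (by fun_prop) measurable_id

end DataB

section DataC

variable {R₀ d₁ : Ω' → ℝ} {R₁ Rₙ : Ω → ℝ} {V : Ω → EuclideanSpace ℝ (Fin 1)}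
  {W : Ω → EuclideanSpace ℝ (Fin n)}

theorem IsDataC.hasLaw [IsProbabilityMeasure P] (h : IsDataC P' R₀ d₁ P R₁ Rₙ V W) :
    HasLaw (fun w => ((R₁ w, Rₙ w), (V w, W w)))
      ((P'.map fun w => (d₁ w * R₀ w, √(1 - d₁ w ^ 2) * R₀ w)).prod
        ((uniformSphere 1).prod (uniformSphere n))) P :=
  h.indep.1.hasLaw_prodMk ⟨h.law_R.aemeasurable_fst, h.law_R.map_eq⟩
    (h.indep.2.hasLaw_prodMk h.law_V h.law_W)

/-- The data fix the joint law of `((R₁, Rₙ), V, W)`, so one realization of (c) transfers to all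
others. -/
theorem IsDataC.identDistrib {Ω₁ : Type*} [MeasurableSpace Ω₁] {P₁ : Measure Ω₁}
    [IsProbabilityMeasure P] [IsProbabilityMeasure P₁] (h : IsDataC P' R₀ d₁ P R₁ Rₙ V W)
    {S₁ Sₙ : Ω₁ → ℝ} {V₁ : Ω₁ → EuclideanSpace ℝ (Fin 1)} {W₁ : Ω₁ → EuclideanSpace ℝ (Fin n)}
    (h₁ : IsDataC P' R₀ d₁ P₁ S₁ Sₙ V₁ W₁) (A : Matrix (Fin n) (Fin n) ℝ) (c m : Fin n → ℝ) :
    IdentDistrib (fun w => (R₁ w * |V w 0|) • c + Rₙ w • (A *ᵥ (W w).ofLp) + m)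
      (fun w => (S₁ w * |V₁ w 0|) • c + Sₙ w • (A *ᵥ (W₁ w).ofLp) + m) P P₁ :=
  (h.hasLaw.identDistrib_of_eq h₁.hasLaw).comp
    (u := fun p : (ℝ × ℝ) × EuclideanSpace ℝ (Fin 1) × EuclideanSpace ℝ (Fin n) =>
      (p.1.1 * |p.2.1 0|) • c + p.1.2 • (A *ᵥ p.2.2.ofLp) + m)
    (Continuous.measurable (by fun_prop))

end DataC

/-- Coordinates `(R₀, U, t, V, W)` on a nested product, with `d₁ = √t` and `d₂ = √(1 - t)` for the
beta coordinate `t`. Each independence separates the first factor of a product from the rest. -/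
theorem exists_isDataA_isDataB (hn : 1 ≤ n) (hg : IsDensityGenerator (n + 1) g) :
    ∃ (Ω₀ : Type) (_ : MeasurableSpace Ω₀) (P₀ : Measure Ω₀) (R₀ d₁ d₂ : Ω₀ → ℝ)
      (U : Ω₀ → EuclideanSpace ℝ (Fin (n + 1))) (V : Ω₀ → EuclideanSpace ℝ (Fin 1))
      (W : Ω₀ → EuclideanSpace ℝ (Fin n)), IsProbabilityMeasure P₀ ∧
        IsDataA g P₀ R₀ U ∧ IsDataB g P₀ R₀ d₁ d₂ V W := by
  have hn' : (0 : ℝ) < n := by exact_mod_cast hn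
  have := hg.isProbabilityMeasure_radialLaw
  have := isProbabilityMeasure_uniformSphere (Nat.le_add_left 1 n)
  have := isProbabilityMeasure_uniformSphere hn
  have := isProbabilityMeasure_uniformSphere (le_refl 1)
  have := isProbabilityMeasureBeta (α := 1 / 2) (β := (n : ℝ) / 2) (by norm_num) (by positivity)
  set ρ := (uniformSphere 1).prod (uniformSphere n)
  set τ := (betaMeasure (1 / 2) ((n : ℝ) / 2)).prod ρ
  set σ := (uniformSphere (n + 1)).prod τ
  set Q := (radialLaw n g).prod σ
  have T1 : MeasurePreserving (fun p : ℝ × EuclideanSpace ℝ (Fin (n + 1)) × ℝ ×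
      EuclideanSpace ℝ (Fin 1) × EuclideanSpace ℝ (Fin n) => p.2) Q σ := measurePreserving_snd
  have T2 : MeasurePreserving (fun p : ℝ × EuclideanSpace ℝ (Fin (n + 1)) × ℝ ×
      EuclideanSpace ℝ (Fin 1) × EuclideanSpace ℝ (Fin n) => p.2.2) Q τ :=
    measurePreserving_snd.comp T1
  have T3 : MeasurePreserving (fun p : ℝ × EuclideanSpace ℝ (Fin (n + 1)) × ℝ ×
      EuclideanSpace ℝ (Fin 1) × EuclideanSpace ℝ (Fin n) => p.2.2.2) Q ρ :=
    measurePreserving_snd.comp T2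
  have hR : HasLaw (fun p : ℝ × EuclideanSpace ℝ (Fin (n + 1)) × ℝ ×
      EuclideanSpace ℝ (Fin 1) × EuclideanSpace ℝ (Fin n) => p.1) (radialLaw n g) Q :=
    measurePreserving_fst.hasLaw
  have hB : HasLaw (fun p : ℝ × EuclideanSpace ℝ (Fin (n + 1)) × ℝ ×
      EuclideanSpace ℝ (Fin 1) × EuclideanSpace ℝ (Fin n) => p.2.2.1)
        (betaMeasure (1 / 2) ((n : ℝ) / 2)) Q := (measurePreserving_fst.comp T2).hasLaw
  have hmem : ∀ᵐ p ∂Q, p.2.2.1 ∈ Ioo (0 : ℝ) 1 :=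
    (measurePreserving_fst.comp T2).quasiMeasurePreserving.ae (ae_mem_Ioo_betaMeasure _ _)
  refine ⟨_, inferInstance, Q, fun p => p.1, fun p => √p.2.2.1, fun p => √(1 - p.2.2.1),
    fun p => p.2.1, fun p => p.2.2.2.1, fun p => p.2.2.2.2, inferInstance,
    ⟨hR, (measurePreserving_fst.comp T1).hasLaw, indepFun_prod measurable_id measurable_fst⟩,
    hR, .of_forall fun _ => Real.sqrt_nonneg _, .of_forall fun _ => Real.sqrt_nonneg _, ?_, ?_,
    (measurePreserving_fst.comp T3).hasLaw, (measurePreserving_snd.comp T3).hasLaw, ?_, ?_, ?_⟩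
  · refine hB.congr ?_
    filter_upwards [hmem] with p hp
    exact Real.sq_sqrt hp.1.le
  · filter_upwards [hmem] with p hp
    rw [Real.sq_sqrt hp.1.le, Real.sq_sqrt (sub_nonneg.2 hp.2.le)]
  · exact indepFun_prod measurable_id (by fun_prop : Measurable fun p :
      EuclideanSpace ℝ (Fin (n + 1)) × ℝ × EuclideanSpace ℝ (Fin 1) × EuclideanSpace ℝ (Fin n) =>
        ((√p.2.1, √(1 - p.2.1)), p.2.2.1, p.2.2.2))
  · exact (indepFun_prod (μ := betaMeasure (1 / 2) ((n : ℝ) / 2)) (ν := ρ)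
      (X := fun t => (√t, √(1 - t))) (by fun_prop) measurable_id).comp_measurePreserving
        (by fun_prop) (by fun_prop) T2
  · exact (indepFun_prod (μ := uniformSphere 1) (ν := uniformSphere n) measurable_id
      measurable_id).comp_measurePreserving (by fun_prop) (by fun_prop) T3

end SkewElliptical

end

theorem theorem3p1 {n : ℕ} (hn : 1 ≤ n)
    (m : Fin n → ℝ) (Om : Matrix (Fin n) (Fin n) ℝ) (hOm : Om.PosDef) (α : Fin n → ℝ)
    (g : ℝ → ℝ) (hg : SkewElliptical.IsDensityGenerator (n + 1) g)
    {Ω : Type*} [MeasurableSpace Ω] (P : Measure Ω) [IsProbabilityMeasure P]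
    (X : Ω → Fin n → ℝ) (hX : HasLaw X (SkewElliptical.skewLaw m Om α g) P) :
    -- `(δ, Ψ)` exists and is determined by `(Ω, α)`
    (∃! p : (Fin n → ℝ) × Matrix (Fin n) (Fin n) ℝ,
      SkewElliptical.IsSkewParam Om α p.1 p.2) ∧
    -- random variables as in the representations exist
    (∃ (Ω₀ : Type) (_ : MeasurableSpace Ω₀) (P₀ : Measure Ω₀) (R₀ d₁ d₂ : Ω₀ → ℝ)
      (U : Ω₀ → EuclideanSpace ℝ (Fin (n + 1))) (V : Ω₀ → EuclideanSpace ℝ (Fin 1))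
      (W : Ω₀ → EuclideanSpace ℝ (Fin n)), IsProbabilityMeasure P₀ ∧
        SkewElliptical.IsDataA g P₀ R₀ U ∧ SkewElliptical.IsDataB g P₀ R₀ d₁ d₂ V W) ∧
    -- and, for all such random variables, on any probability spaces:
    ∀ (δ : Fin n → ℝ) (Psi : Matrix (Fin n) (Fin n) ℝ),
      SkewElliptical.IsSkewParam Om α δ Psi →
      -- (a)
      (∀ {Ω₁ : Type*} [MeasurableSpace Ω₁] (P₁ : Measure Ω₁) [IsProbabilityMeasure P₁]
        (R₀ : Ω₁ → ℝ) (U : Ω₁ → EuclideanSpace ℝ (Fin (n + 1))),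
        SkewElliptical.IsDataA g P₁ R₀ U →
        IdentDistrib X
          (fun w => R₀ w • (|U w 0| • (SkewElliptical.scaleMatrix Om *ᵥ δ) +
            (SkewElliptical.scaleMatrix Om * SkewElliptical.deltaMatrix δ * CFC.sqrt Psi) *ᵥ
              SkewElliptical.tailVec (U w)) + m) P P₁) ∧
      (∀ {Ω₂ : Type*} [MeasurableSpace Ω₂] (P₂ : Measure Ω₂) [IsProbabilityMeasure P₂]
        (R₀ d₁ d₂ : Ω₂ → ℝ) (V : Ω₂ → EuclideanSpace ℝ (Fin 1))
        (W : Ω₂ → EuclideanSpace ℝ (Fin n)),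
        SkewElliptical.IsDataB g P₂ R₀ d₁ d₂ V W →
        -- (b)
        IdentDistrib X
          (fun w => R₀ w • ((d₁ w * |V w 0|) • (SkewElliptical.scaleMatrix Om *ᵥ δ) +
            d₂ w • ((SkewElliptical.scaleMatrix Om * SkewElliptical.deltaMatrix δ *
              CFC.sqrt Psi) *ᵥ (W w).ofLp)) + m) P P₂ ∧
        -- `(U₁, U₂)` has the law of `(d₁ U⁽¹⁾, d₂ U⁽ⁿ⁾)`
        (∀ {Ω₁ : Type*} [MeasurableSpace Ω₁] (P₁ : Measure Ω₁) [IsProbabilityMeasure P₁]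
          (S₀ : Ω₁ → ℝ) (U : Ω₁ → EuclideanSpace ℝ (Fin (n + 1))),
          SkewElliptical.IsDataA g P₁ S₀ U →
          IdentDistrib (fun w => (U w 0, SkewElliptical.tailVec (U w)))
            (fun w => (d₁ w * V w 0, d₂ w • (W w).ofLp)) P₁ P₂) ∧
        -- `R₁ = d₁ R₀` and `Rₙ = (1 - d₁²)^{1/2} R₀` are as required in (c)
        SkewElliptical.IsDataC P₂ R₀ d₁ P₂ (fun w => d₁ w * R₀ w)
          (fun w => √(1 - d₁ w ^ 2) * R₀ w) V W ∧
        -- (c)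
        (∀ {Ω₃ : Type*} [MeasurableSpace Ω₃] (P₃ : Measure Ω₃) [IsProbabilityMeasure P₃]
          (R₁ Rₙ : Ω₃ → ℝ) (V' : Ω₃ → EuclideanSpace ℝ (Fin 1))
          (W' : Ω₃ → EuclideanSpace ℝ (Fin n)),
          SkewElliptical.IsDataC P₂ R₀ d₁ P₃ R₁ Rₙ V' W' →
          IdentDistrib X
            (fun w => (R₁ w * |V' w 0|) • (SkewElliptical.scaleMatrix Om *ᵥ δ) +
              Rₙ w • ((SkewElliptical.scaleMatrix Om * SkewElliptical.deltaMatrix δ *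
                CFC.sqrt Psi) *ᵥ (W' w).ofLp) + m) P P₃)) := by
  refine ⟨SkewElliptical.existsUnique_isSkewParam hOm α,
    SkewElliptical.exists_isDataA_isDataB hn hg, fun δ Psi hp => ⟨?_, ?_⟩⟩
  · intro Ω₁ _ P₁ _ R₀ U h
    refine hX.identDistrib_of_eq ?_
    rw [← hp.map_radialLaw_prod_splitSphere hg hOm m]
    exact h.hasLaw_split.measurable_comp (SkewElliptical.measurable_absAffine _ _ m)
  · intro Ω₂ _ P₂ _ R₀ d₁ d₂ V W h
    have hb := hX.identDistrib_of_eq (h.hasLaw_skewLaw hn hg hOm hp m)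
    refine ⟨hb, ?_, h.isDataC, ?_⟩
    · intro Ω₁ _ P₁ _ S₀ U hA
      exact hA.hasLaw_sphere.identDistrib_of_eq (h.hasLaw_sphere hn)
    · intro Ω₃ _ P₃ _ R₁ Rₙ V' W' h'
      -- Distributing `R₀` in (b), with `d₂ = √(1 - d₁²)` almost surely, gives (c) for `R₁ = d₁R₀`
      -- and `Rₙ = √(1 - d₁²) R₀`, which is then transferred to the given variables.
      refine hb.trans (IdentDistrib.trans (IdentDistrib.of_ae_eq hb.aemeasurable_snd ?_)
        (h.isDataC.identDistrib h' _ _ m))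
      filter_upwards [h.d₂_eq] with w hw
      rw [hw, smul_add, smul_smul, smul_smul]
      ring_nf
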